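/- **Counting formula.** Let $r\ge 1$ and $L\ge 0$ be integers, let $s\in\tfrac12\mathbb Z_{\ge 0}$, and let $\mathfrak g=\mathfrak{su}(r+1)$. Let $\mathrm{Sym}^{2s}(\mathbb C^{r+1})$ be the $2s$-th symmetric power of the defining representation, and let $H=\big(\mathrm{Sym}^{2s}(\mathbb C^{r+1})\big)^{\otimes L}$ be its $L$-fold tensor power. *Multiplicities.* Let $\vec M=(M_1,\dots,M_r)\in\mathbb Z^r$ be such that $$\lambda=(2sL-M_1,\;M_1-M_2,\;\dots,\;M_{r-1}-M_r,\;M_r)$$ is a partition, i.e. its $r+1$ entries are weakly decreasing and nonnegative. Let $V_\lambda$ be the irreducible complex representation of $\mathfrak g$ of highest weight $\lambda$, so that its Dynkin labels are $\lambda_i-\lambda_{i+1}$. The representation $H$ is a direct sum of finitely many irreducible complex representations of $\mathfrak g$. Let $\mu_{s,L}(\vec M)$ be the multiplicity of $V_\lambda$ in $H$, i.e. the number of summands of highest weight $\lambda$ in any such decomposition. *Restricted-occupancy coefficients.* Let $$S_{(2s)}(y_1,\dots,y_{r+1})=\frac{\det\big(y_j^{\nu_i+r+1-i}\big)_{1\le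 i,j\le r+1}}{\det\big(y_j^{r+1-i}\big)_{1\le i,j\le r+1}},\qquad \nu=(2s,0,\dots,0),$$ be the Schur polynomial of the one-row partition $(2s)$. For $\vec m\in\mathbb Z^r$ let $c_{s,L}(\vec m)$ be the coefficient of $x_1^{m_1}\cdots x_r^{m_r}$ in the polynomial $\big[S_{(2s)}(1,x_1,x_1x_2,\dots,x_1x_2\cdots x_r)\big]^L$; in particular $c_{s,L}(\vec m)=0$ if some $m_a<0$. *Shift operator.* Let $$\chi(\mathfrak g)^{-1}=\prod_{1\le a\le b\le r}\big(1-t_at_{a+1}\cdots t_b\big)=\sum_\beta \epsilon_\beta\, t_1^{\beta_1}\cdots t_r^{\beta_r}$$ be the Weyl denominator of $\mathfrak g$. For a function $f$ on $\mathbb Z^r$ put $$\mathcal D_{\chi(\mathfrak g)^{-1}}f(\vec M)=\sum_\beta \epsilon_\beta\, f(M_1-\beta_1,\dots,M_r-\beta_r).$$ Then $H$ has such a decomposition into irreducible representations, and for every such decomposition $$\mu_{s,L}(\vec M)=\mathcal D_{\chi(\mathfrak g)^{-1}}\,c_{s,L}(\vec M).$$ -/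

import Mathlib

open scoped TensorProduct

noncomputable section

namespace SpinChain

attribute [local instance 100] LieRing.ofAssociativeRing

/-! ### The Lie algebra `su(n)` and the tensor powers of its symmetric representations -/

/-- The real Lie algebra `su(n)` of traceless skew-Hermitian `n × n` matrices. -/
def su (n : ℕ) : LieSubalgebra ℝ (Matrix (Fin n) (Fin n) ℂ) where
  carrier := {A | A.conjTranspose = -A ∧ A.trace = 0}
  zero_mem' := by simp
  add_mem' := by
    rintro A B ⟨hA, hA'⟩ ⟨hB, hB'⟩
    refine ⟨?_, ?_⟩
    · rw [Matrix.conjTranspose_add, hA, hB, neg_add]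
    · rw [Matrix.trace_add, hA', hB', add_zero]
  smul_mem' := by
    rintro c A ⟨hA, hA'⟩
    refine ⟨?_, ?_⟩
    · rw [Matrix.conjTranspose_smul, hA]; simp
    · rw [Matrix.trace_smul, hA', smul_zero]
  lie_mem' := by
    rintro A B ⟨hA, -⟩ ⟨hB, -⟩
    refine ⟨?_, ?_⟩
    · simp only [Ring.lie_def, Matrix.conjTranspose_sub, Matrix.conjTranspose_mul, hA, hB]
      simp
    · simp only [Ring.lie_def, Matrix.trace_sub]
      rw [Matrix.trace_mul_comm, sub_self]

/-- The derivation of `ℂ[X₀, …, X_{n-1}]` that extends the action of the matrix `A` on `ℂⁿ`, the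
variable `X_j` standing for the `j`-th standard basis vector: `X_j ↦ ∑ i, A i j * X_i`. -/
def matrixDerivation {n : ℕ} (A : Matrix (Fin n) (Fin n) ℂ) :
    Derivation ℂ (MvPolynomial (Fin n) ℂ) (MvPolynomial (Fin n) ℂ) :=
  MvPolynomial.mkDerivation ℂ fun j => ∑ i, A i j • MvPolynomial.X i

theorem matrixDerivation_isHomogeneous {n k : ℕ} (A : Matrix (Fin n) (Fin n) ℂ)
    {p : MvPolynomial (Fin n) ℂ} (hp : p ∈ MvPolynomial.homogeneousSubmodule (Fin n) ℂ k) :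
    matrixDerivation A p ∈ MvPolynomial.homogeneousSubmodule (Fin n) ℂ k := by
  rw [MvPolynomial.mem_homogeneousSubmodule] at hp
  rw [p.as_sum, map_sum]
  refine Submodule.sum_mem _ fun d hd => ?_
  have hdeg : d.degree = k := by
    have h := hp (MvPolynomial.mem_support_iff.mp hd)
    exact (DFunLike.congr_fun Finsupp.degree_eq_weight_one d).trans h
  rw [matrixDerivation, MvPolynomial.mkDerivation_monomial]
  refine Submodule.smul_mem _ _ (Submodule.sum_mem _ fun j hj => ?_)
  simp only [smul_eq_mul, Finset.mul_sum, mul_smul_comm]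
  refine Submodule.sum_mem _ fun i _ => Submodule.smul_mem _ _ ?_
  rw [MvPolynomial.mem_homogeneousSubmodule]
  have hle : Finsupp.single j 1 ≤ d :=
    Finsupp.single_le_iff.mpr (Nat.one_le_iff_ne_zero.mpr (Finsupp.mem_support_iff.mp hj))
  have hk : (d - Finsupp.single j 1).degree + 1 = k := by
    have h : (d - Finsupp.single j 1 + Finsupp.single j 1).degree = k := by
      rw [tsub_add_cancel_of_le hle, hdeg]
    rwa [map_add, Finsupp.degree_single] at h
  rw [← hk]
  exact (MvPolynomial.isHomogeneous_monomial _ rfl).mul (MvPolynomial.isHomogeneous_X _ _)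

theorem matrixDerivation_X {n : ℕ} (A : Matrix (Fin n) (Fin n) ℂ) (j : Fin n) :
    matrixDerivation A (MvPolynomial.X j) = ∑ i, A i j • MvPolynomial.X i :=
  MvPolynomial.mkDerivation_X _ _ _

theorem matrixDerivation_add {n : ℕ} (A B : Matrix (Fin n) (Fin n) ℂ) :
    matrixDerivation (A + B) = matrixDerivation A + matrixDerivation B := by
  refine MvPolynomial.derivation_ext fun j => ?_
  simp [matrixDerivation_X, add_smul, Finset.sum_add_distrib]

theorem matrixDerivation_smul {n : ℕ} (c : ℂ) (A : Matrix (Fin n) (Fin n) ℂ) :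
    matrixDerivation (c • A) = c • matrixDerivation A := by
  refine MvPolynomial.derivation_ext fun j => ?_
  simp [matrixDerivation_X, mul_smul, Finset.smul_sum]

theorem matrixDerivation_lie {n : ℕ} (A B : Matrix (Fin n) (Fin n) ℂ) :
    matrixDerivation ⁅A, B⁆ = ⁅matrixDerivation A, matrixDerivation B⁆ := by
  have key : ∀ (A B : Matrix (Fin n) (Fin n) ℂ) (j : Fin n),
      matrixDerivation A (matrixDerivation B (MvPolynomial.X j)) =
        ∑ i, (A * B) i j • MvPolynomial.X i := by
    intro A B j
    simp only [matrixDerivation_X, map_sum, Derivation.map_smul, Matrix.mul_apply, Finset.sum_smul,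
      Finset.smul_sum]
    rw [Finset.sum_comm]
    refine Finset.sum_congr rfl fun i _ => Finset.sum_congr rfl fun l _ => ?_
    rw [smul_smul, mul_comm]
  refine MvPolynomial.derivation_ext fun j => ?_
  rw [Derivation.commutator_apply, key, key, matrixDerivation_X]
  simp [Ring.lie_def, sub_smul, Finset.sum_sub_distrib]

/-- The `k`-th symmetric power of the defining representation `ℂⁿ`, realised on the homogeneous
polynomials of degree `k` in the standard basis vectors of `ℂⁿ`. -/
abbrev SymSpace (n k : ℕ) : Type := MvPolynomial.homogeneousSubmodule (Fin n) ℂ k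

/-- The action of complex matrices on the `k`-th symmetric power of `ℂⁿ`. -/
def symRep (n k : ℕ) : Matrix (Fin n) (Fin n) ℂ →ₗ⁅ℂ⁆ Module.End ℂ (SymSpace n k) where
  toFun A := (matrixDerivation A).toLinearMap.restrict
    fun _ hp => matrixDerivation_isHomogeneous A hp
  map_add' A B := by
    ext p : 2
    simp [LinearMap.restrict_apply, matrixDerivation_add]
  map_smul' c A := by
    ext p : 2
    simp [LinearMap.restrict_apply, matrixDerivation_smul]
  map_lie' {A B} := by
    ext p : 2
    have h := DFunLike.congr_fun (matrixDerivation_lie A B) (p : MvPolynomial (Fin n) ℂ)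
    rw [Derivation.commutator_apply] at h
    simpa [LinearMap.restrict_apply, Ring.lie_def] using h

/-- The `L`-fold tensor power of a complex vector space. -/
abbrev TensorSpace (V : Type*) [AddCommGroup V] [Module ℂ V] (L : ℕ) : Type _ := ⨂[ℂ]^L V

instance instAddCommGroupTensorSpace (V : Type*) [AddCommGroup V] [Module ℂ V] (L : ℕ) :
    AddCommGroup (TensorSpace V L) :=
  inferInstanceAs (AddCommGroup (⨂[ℂ] _i : Fin L, V))

/-- The action of `x` on the `L`-fold tensor power of a representation `ρ`:
`∑ i, 1 ⊗ ⋯ ⊗ ρ x ⊗ ⋯ ⊗ 1`, with `ρ x` in the `i`-th place. -/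
def tensorRep {g V : Type*} [LieRing g] [LieAlgebra ℂ g] [AddCommGroup V] [Module ℂ V]
    (ρ : g →ₗ⁅ℂ⁆ Module.End ℂ V) (L : ℕ) : g →ₗ⁅ℂ⁆ Module.End ℂ (TensorSpace V L) where
  toFun x := ∑ i : Fin L, PiTensorProduct.map
    (Function.update (fun _ : Fin L => (LinearMap.id : V →ₗ[ℂ] V)) i (ρ x))
  map_add' x y := by
    simp only [map_add, PiTensorProduct.map_update_add, Finset.sum_add_distrib]
  map_smul' c x := by
    simp only [map_smul, PiTensorProduct.map_update_smul, Finset.smul_sum, RingHom.id_apply]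
  map_lie' {x y} := by
    have hlie : ∀ i : Fin L,
        PiTensorProduct.map (Function.update (fun _ : Fin L => (LinearMap.id : V →ₗ[ℂ] V)) i (ρ ⁅x, y⁆)) =
          PiTensorProduct.map (Function.update (fun _ : Fin L => (LinearMap.id : V →ₗ[ℂ] V)) i (ρ x)) *
              PiTensorProduct.map (Function.update (fun _ : Fin L => (LinearMap.id : V →ₗ[ℂ] V)) i (ρ y)) -
            PiTensorProduct.map (Function.update (fun _ : Fin L => (LinearMap.id : V →ₗ[ℂ] V)) i (ρ y)) *
              PiTensorProduct.map (Function.update (fun _ : Fin L => (LinearMap.id : V →ₗ[ℂ] V)) i (ρ x)) := by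
      intro i
      have hmul : ∀ a b : Module.End ℂ V,
          PiTensorProduct.map (Function.update (fun _ : Fin L => (LinearMap.id : V →ₗ[ℂ] V)) i a) *
              PiTensorProduct.map (Function.update (fun _ : Fin L => (LinearMap.id : V →ₗ[ℂ] V)) i b) =
            PiTensorProduct.map (Function.update (fun _ : Fin L => (LinearMap.id : V →ₗ[ℂ] V)) i (a * b)) := by
        intro a b
        rw [← PiTensorProduct.map_mul]
        congr 1
        funext j
        by_cases hj : j = i
        · subst hj; simp
        · simp only [Function.update_of_ne hj]; rfl
      have hsub : ∀ a b : Module.End ℂ V,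
          PiTensorProduct.map (Function.update (fun _ : Fin L => (LinearMap.id : V →ₗ[ℂ] V)) i (a - b)) =
            PiTensorProduct.map (Function.update (fun _ : Fin L => (LinearMap.id : V →ₗ[ℂ] V)) i a) -
            PiTensorProduct.map (Function.update (fun _ : Fin L => (LinearMap.id : V →ₗ[ℂ] V)) i b) := by
        intro a b
        rw [eq_sub_iff_add_eq, ← PiTensorProduct.map_update_add, sub_add_cancel]
      rw [LieHom.map_lie, Ring.lie_def, hsub, hmul, hmul]
    have hcomm : ∀ i j : Fin L, i ≠ j → ∀ a b : Module.End ℂ V,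
        PiTensorProduct.map (Function.update (fun _ : Fin L => (LinearMap.id : V →ₗ[ℂ] V)) i a) *
            PiTensorProduct.map (Function.update (fun _ : Fin L => (LinearMap.id : V →ₗ[ℂ] V)) j b) =
          PiTensorProduct.map (Function.update (fun _ : Fin L => (LinearMap.id : V →ₗ[ℂ] V)) j b) *
            PiTensorProduct.map (Function.update (fun _ : Fin L => (LinearMap.id : V →ₗ[ℂ] V)) i a) := by
      intro i j hij a b
      rw [← PiTensorProduct.map_mul, ← PiTensorProduct.map_mul]
      congr 1
      funext l
      by_cases hl : l = i
      · subst hl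
        simp only [Function.update_self, Function.update_of_ne hij]; rfl
      · simp only [Function.update_of_ne hl]; rfl
    rw [Ring.lie_def, Finset.sum_mul_sum, Finset.sum_mul_sum, Finset.sum_comm,
      ← Finset.sum_sub_distrib]
    refine Finset.sum_congr rfl fun i _ => ?_
    rw [← Finset.sum_sub_distrib, hlie, Finset.sum_eq_single i]
    · intro j _ hj
      rw [hcomm j i hj, sub_self]
    · intro h
      exact absurd (Finset.mem_univ i) h

/-- The Hilbert space of the chain: the `L`-fold tensor power of the `k`-th symmetric power of
`ℂ^(r+1)`. -/
abbrev ChainSpace (r k L : ℕ) : Type := TensorSpace (SymSpace (r + 1) k) L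

/-- The action of complex matrices on the chain. It is complex-linear in the matrix; on `su(r+1)`
it is the tensor power of the symmetric representation, and on the traceless matrices it is the
action of the complexification `sl(r+1, ℂ)`. -/
def chainRep (r k L : ℕ) :
    Matrix (Fin (r + 1)) (Fin (r + 1)) ℂ →ₗ⁅ℂ⁆ Module.End ℂ (ChainSpace r k L) :=
  tensorRep (symRep (r + 1) k) L

section Representations

variable {n : ℕ} {V : Type*} [AddCommGroup V] [Module ℂ V]
  (ρ : Matrix (Fin n) (Fin n) ℂ →ₗ⁅ℂ⁆ Module.End ℂ V)

/-- `W` is stable under the action of `su(n)`. -/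
def IsSubrep (W : Submodule ℂ V) : Prop :=
  ∀ A ∈ su n, ∀ v ∈ W, ρ A v ∈ W

/-- `W` is an irreducible representation of `su(n)`. -/
def IsIrredSubrep (W : Submodule ℂ V) : Prop :=
  IsSubrep ρ W ∧ W ≠ ⊥ ∧ ∀ U : Submodule ℂ V, U ≤ W → IsSubrep ρ U → U = ⊥ ∨ U = W

/-- `W` contains a highest-weight vector whose weight is the restriction of `lam` to the diagonal
traceless matrices: a nonzero vector that is annihilated by the root vectors `E_ij`, `i < j`, of the
positive roots, and on which `E_ii - E_jj` acts as `lam i - lam j`. -/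
def HasHighestWeight (W : Submodule ℂ V) (lam : Fin n → ℤ) : Prop :=
  ∃ v ∈ W, v ≠ 0 ∧ (∀ i j : Fin n, i < j → ρ (Matrix.single i j 1) v = 0) ∧
    ∀ i j : Fin n, ρ (Matrix.single i i 1 - Matrix.single j j 1) v = ((lam i - lam j : ℤ) : ℂ) • v

/-- A decomposition of `V` into a direct sum of finitely many irreducible representations of
`su(n)`. -/
structure IrredDecomposition where
  num : ℕ
  summand : Fin num → Submodule ℂ V
  isInternal : DirectSum.IsInternal summand
  irred : ∀ a, IsIrredSubrep ρ (summand a)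

/-- The number of summands that are irreducible representations with highest weight `lam`. -/
def IrredDecomposition.count {ρ : Matrix (Fin n) (Fin n) ℂ →ₗ⁅ℂ⁆ Module.End ℂ V}
    (D : IrredDecomposition ρ) (lam : Fin n → ℤ) : ℕ :=
  Nat.card {a : Fin D.num // HasHighestWeight ρ (D.summand a) lam}

end Representations

/-! ### Schur polynomials and the restricted-occupancy coefficients -/

/-- The alternant `det (x_j ^ (e i))` in the variables `x_0, …, x_{n-1}`. -/
def alternant {n : ℕ} (e : Fin n → ℕ) : MvPolynomial (Fin n) ℤ :=
  Matrix.det (Matrix.of fun i j : Fin n => MvPolynomial.X j ^ e i)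

theorem alternant_vandermonde (n : ℕ) :
    Associated (Matrix.vandermonde fun i : Fin n => (MvPolynomial.X i : MvPolynomial (Fin n) ℤ)).det
      (alternant fun i : Fin n => n - 1 - (i : ℕ)) := by
  have h : (Matrix.of fun i j : Fin n =>
      (MvPolynomial.X j : MvPolynomial (Fin n) ℤ) ^ (n - 1 - (i : ℕ))) =
      (Matrix.vandermonde fun i : Fin n =>
        (MvPolynomial.X i : MvPolynomial (Fin n) ℤ)).transpose.submatrix Fin.revPerm id := by
    ext1 i j
    simp only [Matrix.of_apply, Matrix.submatrix_apply, Matrix.transpose_apply,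
      Matrix.vandermonde_apply, Fin.revPerm_apply, Fin.val_rev, id]
    congr 1
    omega
  rw [alternant, h, Matrix.det_permute, Matrix.det_transpose]
  refine ⟨Units.map (Int.castRingHom (MvPolynomial (Fin n) ℤ)).toMonoidHom
    (Equiv.Perm.sign (Fin.revPerm : Equiv.Perm (Fin n))), ?_⟩
  rw [mul_comm]
  rfl

theorem sub_dvd_alternant {n : ℕ} (e : Fin n → ℕ) {i j : Fin n} (hij : i ≠ j) :
    (MvPolynomial.X j - MvPolynomial.X i : MvPolynomial (Fin n) ℤ) ∣ alternant e := by
  rw [← Ideal.mem_span_singleton, ← Ideal.Quotient.eq_zero_iff_mem, alternant, RingHom.map_det]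
  refine Matrix.det_zero_of_column_eq hij fun a => ?_
  have h : Ideal.Quotient.mk (Ideal.span
      {(MvPolynomial.X j - MvPolynomial.X i : MvPolynomial (Fin n) ℤ)}) (MvPolynomial.X i) =
      Ideal.Quotient.mk _ (MvPolynomial.X j) := by
    rw [eq_comm, Ideal.Quotient.eq]
    exact Ideal.mem_span_singleton_self _
  simp only [RingHom.mapMatrix_apply, Matrix.map_apply, Matrix.of_apply, map_pow, h]

theorem irreducible_X_sub_X {n : ℕ} {i j : Fin n} (hij : i ≠ j) :
    Irreducible (MvPolynomial.X j - MvPolynomial.X i : MvPolynomial (Fin n) ℤ) := by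
  have h : (MvPolynomial.X j - MvPolynomial.X i : MvPolynomial (Fin n) ℤ) =
      MvPolynomial.sumSMulX (Finsupp.single j 1 - Finsupp.single i 1) := by
    simp [MvPolynomial.sumSMulX]
  have hj : (Finsupp.single j 1 - Finsupp.single i 1 : Fin n →₀ ℤ) j = 1 := by
    simp [hij]
  rw [h]
  refine MvPolynomial.irreducible_sumSMulX _ ⟨j, ?_⟩ fun r hr => ?_
  · rw [Finsupp.mem_support_iff, hj]
    exact one_ne_zero
  · have := hr j
    rw [hj] at this
    exact isUnit_of_dvd_one this

theorem alternant_dvd {n : ℕ} (e : Fin n → ℕ) :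
    alternant (fun i : Fin n => n - 1 - (i : ℕ)) ∣ alternant e := by
  obtain ⟨u, hu⟩ := alternant_vandermonde n
  rw [← hu, Units.mul_right_dvd, Matrix.det_vandermonde, Finset.prod_sigma']
  refine Finset.prod_dvd_of_isRelPrime ?_ ?_
  · rintro ⟨i, j⟩ hp ⟨i', j'⟩ hp' hne
    have hij : i < j := by simpa using hp
    have hij' : i' < j' := by simpa using hp'
    refine (irreducible_X_sub_X hij.ne).isRelPrime_iff_not_dvd.mpr ?_
    rintro ⟨q, hq⟩
    have h := congrArg (MvPolynomial.eval fun a : Fin n => if a = j then ((i : ℕ) : ℤ) else (a : ℕ)) hq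
    simp only [map_mul, map_sub, MvPolynomial.eval_X, if_true, if_neg hij.ne, sub_self, zero_mul]
      at h
    refine hne ?_
    have : i = i' ∧ j = j' := by
      split_ifs at h <;> constructor <;> omega
    obtain ⟨rfl, rfl⟩ := this
    rfl
  · rintro ⟨i, j⟩ hp
    have hij : i < j := by simpa using hp
    exact sub_dvd_alternant e hij.ne

theorem alternant_ne_zero (n : ℕ) : alternant (fun i : Fin n => n - 1 - (i : ℕ)) ≠ 0 := by
  obtain ⟨u, hu⟩ := alternant_vandermonde n
  rw [← hu]
  refine mul_ne_zero ?_ u.ne_zero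
  exact Matrix.det_vandermonde_ne_zero_iff.mpr MvPolynomial.X_injective

/-- The Schur polynomial of `lam` in `n` variables, the quotient
`det (x_j ^ (lam i + n - 1 - i)) / det (x_j ^ (n - 1 - i))` with `i` and `j` running from `0` to
`n - 1`. -/
def schur {n : ℕ} (lam : Fin n → ℕ) : MvPolynomial (Fin n) ℤ :=
  (alternant_dvd fun i : Fin n => lam i + (n - 1 - (i : ℕ))).choose

theorem schur_spec {n : ℕ} (lam : Fin n → ℕ) :
    alternant (fun i : Fin n => lam i + (n - 1 - (i : ℕ))) =
      alternant (fun i : Fin n => n - 1 - (i : ℕ)) * schur lam :=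
  (alternant_dvd fun i : Fin n => lam i + (n - 1 - (i : ℕ))).choose_spec

/-- The generating function `[S_(k)(1, x_1, x_1 x_2, …, x_1 ⋯ x_r)] ^ L`, where `S_(k)` is the Schur
polynomial of the one-row partition `(k, 0, …, 0)` with `r + 1` parts. The variable `x_a` is
`X (a - 1)`. -/
def generatingFunction (r k L : ℕ) : MvPolynomial (Fin r) ℤ :=
  (MvPolynomial.aeval
    (fun j : Fin (r + 1) => ∏ i ∈ Finset.univ.filter (fun i : Fin r => (i : ℕ) < (j : ℕ)),
      (MvPolynomial.X i : MvPolynomial (Fin r) ℤ))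
    (schur fun i : Fin (r + 1) => if i = 0 then k else 0)) ^ L

/-- The restricted-occupancy coefficient: the coefficient of `x_1 ^ M_1 ⋯ x_r ^ M_r` in the
generating function, which is `0` if some `M_a` is negative. -/
def occupancy (r k L : ℕ) (M : Fin r → ℤ) : ℤ :=
  if ∀ i, 0 ≤ M i then
    (generatingFunction r k L).coeff (Finsupp.equivFunOnFinite.symm fun i => (M i).toNat)
  else 0

/-! ### The Weyl denominator and the shift operator -/

/-- The Weyl denominator `∏ (1 - t^α)` of `su(r+1)`. The positive roots are the sums
`α_a + α_{a+1} + ⋯ + α_b` of consecutive simple roots, `a ≤ b`. -/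
def weylDenominator (r : ℕ) : MvPolynomial (Fin r) ℤ :=
  ∏ p : Fin r × Fin r with p.1 ≤ p.2, (1 - ∏ i ∈ Finset.Icc p.1 p.2, MvPolynomial.X i)

/-- The shift operator of the polynomial `P`: each monomial `t^β` of `P` shifts `M` by `-β`, and is
taken with its coefficient in `P`. -/
def shiftOperator {r : ℕ} (P : MvPolynomial (Fin r) ℤ) (f : (Fin r → ℤ) → ℤ) (M : Fin r → ℤ) : ℤ :=
  ∑ β ∈ P.support, P.coeff β * f fun i => M i - (β i : ℤ)

/-- The rows `(k L - M_1, M_1 - M_2, …, M_{r-1} - M_r, M_r)`. -/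
def weightOf (r k L : ℕ) (M : Fin r → ℤ) (i : Fin (r + 1)) : ℤ :=
  (Fin.cons ((k : ℤ) * L) M : Fin (r + 1) → ℤ) i - (Fin.snoc M 0 : Fin (r + 1) → ℤ) i

end SpinChain

end

/-! Write δ for the exponents (n-1, …, 1, 0), with n = r + 1 and k = 2s. The formula is the Weyl
character formula, read off at one coefficient: multiplying the character of `H` by the Vandermonde
product and taking the coefficient of x^(λ+δ) counts the summands of highest weight λ.

For an irreducible summand W with highest weight ν and equivariant projection p, `traceGen` of p is
the character of W. The quadratic Casimir is a scalar on W; by the commutation relations and the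
cyclicity of the trace, this says that Vandermonde times character is an eigenvector of the
Laplacian ∑ (x_i ∂_i)² with eigenvalue |ν+δ|² (`sum_euler_euler_vdm_mul_traceGen`). Hence its
monomials x^m satisfy |m|² = |ν+δ|². If x^(λ+δ) occurs, the rearrangement inequality also gives
⟨λ+δ, λ⟩ ≤ ⟨λ+δ, ν⟩, and the two facts force ν = λ. For ν = λ the coefficient is 1, because only the
identity permutation and the one-dimensional top weight space contribute (`coeff_vdm_mul_traceGen`).
Neither the full alternating sum nor the Weyl-group symmetry of characters is needed.

Decompositions exist because `su n` acts by skew-adjoint operators for a suitable inner product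
(`nonempty_irredDecomposition`). The character of `H` is the L-th power of the complete homogeneous
polynomial, which is the one-row Schur polynomial (`schur_one_row`). Finally y_j ↦ x_1 ⋯ x_j turns
the Vandermonde product into a monomial times the Weyl denominator and merges no monomials of equal
degree (`rootSubst_alternant`, `coeff_rootSubst`); multiplication by the denominator is the shift
operator. -/

open scoped TensorProduct

noncomputable section

namespace SpinChain

attribute [local instance 100] LieRing.ofAssociativeRing

/-! ### Alternants, Euler operators and the Laplacian of Vandermonde times a polynomial. -/

section Alternants

open MvPolynomial

/-- The exponents `(n - 1, n - 2, …, 0)` of the Vandermonde alternant. -/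
def staircase (n : ℕ) (i : Fin n) : ℕ := n - 1 - (i : ℕ)

theorem staircase_strictAnti (n : ℕ) : StrictAnti (staircase n) := by
  intro i j hij
  have := Fin.lt_def.mp hij
  have := j.isLt
  simp only [staircase]
  omega

/-- Pairs `i < j` of indices. -/
abbrev posPairs (n : ℕ) : Finset (Fin n × Fin n) := Finset.univ.filter fun p => p.1 < p.2

theorem sum_posPairs_fst {n : ℕ} {A : Type*} [Semiring A] (f : Fin n → A) :
    ∑ p ∈ posPairs n, f p.1 = ∑ i, (staircase n i : A) * f i := by
  rw [Finset.sum_filter, Fintype.sum_prod_type]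
  refine Finset.sum_congr rfl fun i _ => ?_
  simp only
  rw [← Finset.sum_filter, Finset.sum_const]
  have : (Finset.univ.filter fun j : Fin n => i < j) = Finset.Ioi i := by ext; simp
  rw [this, Fin.card_Ioi, nsmul_eq_mul]
  rfl

theorem sum_posPairs_snd {n : ℕ} {A : Type*} [Semiring A] (f : Fin n → A) :
    ∑ p ∈ posPairs n, f p.2 = ∑ i : Fin n, ((i : ℕ) : A) * f i := by
  rw [Finset.sum_filter, Fintype.sum_prod_type, Finset.sum_comm]
  refine Finset.sum_congr rfl fun j _ => ?_
  simp only
  rw [← Finset.sum_filter, Finset.sum_const]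
  have : (Finset.univ.filter fun i : Fin n => i < j) = Finset.Iio j := by ext; simp
  rw [this, Fin.card_Iio, nsmul_eq_mul]

theorem prod_posPairs {n : ℕ} {A : Type*} [CommMonoid A] (f : Fin n → Fin n → A) :
    ∏ p ∈ posPairs n, f p.1 p.2 = ∏ i, ∏ j ∈ Finset.Ioi i, f i j := by
  rw [Finset.prod_filter, Fintype.prod_prod_type]
  refine Finset.prod_congr rfl fun i _ => ?_
  simp only
  rw [← Finset.prod_filter]
  refine Finset.prod_congr ?_ fun _ _ => rfl
  ext; simp

theorem alternant_staircase (n : ℕ) :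
    alternant (staircase n) = ∏ p ∈ posPairs n, (X p.1 - X p.2) := by
  rw [prod_posPairs fun i j => (X i - X j : MvPolynomial (Fin n) ℤ)]
  have h := Matrix.det_projVandermonde (1 : Fin n → MvPolynomial (Fin n) ℤ) (fun i => X i)
  simp only [Pi.one_apply, one_mul] at h
  rw [← h, alternant, ← Matrix.det_transpose]
  congr 1
  ext1 i j
  simp only [Matrix.transpose_apply, Matrix.of_apply, Matrix.projVandermonde_apply, Pi.one_apply,
    one_pow, one_mul, Fin.val_rev, staircase]
  congr 1
  omega

theorem alternant_eq_sum {n : ℕ} (e : Fin n → ℕ) :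
    alternant e = ∑ σ : Equiv.Perm (Fin n),
      monomial (Finsupp.equivFunOnFinite.symm fun j => e (σ j)) ((Equiv.Perm.sign σ : ℤˣ) : ℤ) := by
  rw [alternant, Matrix.det_apply]
  refine Finset.sum_congr rfl fun σ _ => ?_
  simp only [Matrix.of_apply]
  rw [monomial_eq, Finsupp.prod_fintype _ _ (by simp), Units.smul_def, zsmul_eq_mul]
  simp

/-- The Euler operator `x_i ∂/∂x_i`. -/
def euler {n : ℕ} {R : Type*} [CommRing R] (i : Fin n) :
    Derivation R (MvPolynomial (Fin n) R) (MvPolynomial (Fin n) R) :=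
  (X i : MvPolynomial (Fin n) R) • pderiv i

theorem euler_X {n : ℕ} {R : Type*} [CommRing R] (i j : Fin n) :
    euler i (X j : MvPolynomial (Fin n) R) = if i = j then X j else 0 := by
  rw [euler, Derivation.smul_apply, pderiv_X, Pi.single_apply]
  by_cases h : i = j
  · subst h; simp
  · simp [h, eq_comm]

theorem euler_monomial {n : ℕ} {R : Type*} [CommRing R] (i : Fin n) (m : Fin n →₀ ℕ) (c : R) :
    euler i (monomial m c) = monomial m ((m i : R) * c) := by
  rw [euler, Derivation.smul_apply, smul_eq_mul, X_mul_pderiv_monomial, ← map_nsmul, nsmul_eq_mul]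

theorem coeff_euler {n : ℕ} {R : Type*} [CommRing R] (i : Fin n) (m : Fin n →₀ ℕ)
    (p : MvPolynomial (Fin n) R) : coeff m (euler i p) = (m i : R) * coeff m p := by
  classical
  induction p using MvPolynomial.induction_on' with
  | monomial u a =>
    rw [euler_monomial, coeff_monomial, coeff_monomial]
    split_ifs with h
    · rw [h]
    · simp
  | add p q hp hq => rw [map_add, coeff_add, coeff_add, hp, hq, mul_add]

/-- The Vandermonde product with complex coefficients. -/
def vdm (n : ℕ) : MvPolynomial (Fin n) ℂ := map (Int.castRingHom ℂ) (alternant (staircase n))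

theorem vdm_eq_prod (n : ℕ) : vdm n = ∏ p ∈ posPairs n, (X p.1 - X p.2) := by
  simp [vdm, alternant_staircase, map_prod]

theorem vdm_eq_sum (n : ℕ) : vdm n = ∑ σ : Equiv.Perm (Fin n),
    monomial (Finsupp.equivFunOnFinite.symm fun j => staircase n (σ j))
      (((Equiv.Perm.sign σ : ℤˣ) : ℤ) : ℂ) := by
  simp [vdm, alternant_eq_sum, map_monomial]

/-- Every exponent of the Vandermonde product is a permutation of the staircase, so all have the
same sum of squares. -/
theorem sum_euler_euler_vdm (n : ℕ) :
    ∑ i, euler i (euler i (vdm n)) = C (∑ i, (staircase n i : ℂ) ^ 2) * vdm n := by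
  rw [vdm_eq_sum]
  simp only [map_sum (euler _), euler_monomial]
  rw [Finset.sum_comm, Finset.mul_sum]
  refine Finset.sum_congr rfl fun σ _ => ?_
  rw [C_mul_monomial, ← map_sum, Finset.sum_mul,
    ← Equiv.sum_comp σ fun i => (staircase n i : ℂ) ^ 2 * _]
  congr 1
  refine Finset.sum_congr rfl fun i _ => ?_
  simp only [Finsupp.equivFunOnFinite_symm_apply_apply]
  ring

theorem derivation_prod {R A ι : Type*} [CommRing R] [CommRing A] [Algebra R A] [DecidableEq ι]
    (D : Derivation R A A) (s : Finset ι) (f : ι → A) :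
    D (∏ i ∈ s, f i) = ∑ i ∈ s, (∏ j ∈ s.erase i, f j) * D (f i) := by
  induction s using Finset.induction_on with
  | empty => simp
  | insert a s ha ih =>
    rw [Finset.prod_insert ha, Derivation.leibniz, ih, Finset.sum_insert ha,
      Finset.erase_insert ha, add_comm, smul_eq_mul, smul_eq_mul, Finset.mul_sum]
    congr 1
    refine Finset.sum_congr rfl fun i hi => ?_
    rw [Finset.erase_insert_of_ne (by rintro rfl; exact ha hi),
      Finset.prod_insert (fun h => ha (Finset.mem_of_mem_erase h)), mul_assoc]

/-- `T i j` stands for the trace of E_ij E_ji. Differentiating the factor x_i - x_j leaves x_i D_i G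
- x_j D_j G, with D_i the Euler operator. Twice this is (x_i - x_j)(D_i G + D_j G) + (x_i + x_j)(D_i
G - D_j G), and by `hT` and `hG` the last product is (x_i - x_j)(T_ij + T_ji); so the missing factor
reappears without division. -/
theorem two_mul_sum_euler_vdm_mul {n : ℕ} (G : MvPolynomial (Fin n) ℂ)
    (T : Fin n → Fin n → MvPolynomial (Fin n) ℂ)
    (hT : ∀ i j, i ≠ j → X j * T i j = X i * T j i)
    (hG : ∀ i j, i ≠ j → T i j - T j i = euler i G - euler j G) :
    2 * ∑ i, euler i (vdm n) * euler i G = vdm n *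
      ∑ p ∈ posPairs n, (T p.1 p.2 + T p.2 p.1 + (euler p.1 G + euler p.2 G)) := by
  classical
  have hD : ∀ i, euler i (vdm n) = ∑ p ∈ posPairs n,
      (∏ q ∈ (posPairs n).erase p, (X q.1 - X q.2)) * euler i (X p.1 - X p.2) := by
    intro i
    rw [vdm_eq_prod, derivation_prod]
  simp only [hD, Finset.sum_mul]
  rw [Finset.sum_comm, Finset.mul_sum, Finset.mul_sum]
  refine Finset.sum_congr rfl fun p hp => ?_
  have hlt : p.1 < p.2 := by simpa using hp
  have hv : vdm n = (X p.1 - X p.2) * ∏ q ∈ (posPairs n).erase p, (X q.1 - X q.2) := by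
    rw [vdm_eq_prod]
    exact (Finset.mul_prod_erase _ _ hp).symm
  have hs : ∑ i, (∏ q ∈ (posPairs n).erase p, (X q.1 - X q.2 : MvPolynomial (Fin n) ℂ)) *
      euler i (X p.1 - X p.2) * euler i G =
      (∏ q ∈ (posPairs n).erase p, (X q.1 - X q.2)) *
        (X p.1 * euler p.1 G - X p.2 * euler p.2 G) := by
    simp only [mul_assoc, ← Finset.mul_sum, map_sub, euler_X, sub_mul, ite_mul, zero_mul,
      Finset.sum_sub_distrib, Finset.sum_ite_eq', Finset.mem_univ, if_true]
  rw [hs, hv]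
  have h1 := hT p.1 p.2 hlt.ne
  have h2 := hG p.1 p.2 hlt.ne
  generalize (∏ q ∈ (posPairs n).erase p, (X q.1 - X q.2 : MvPolynomial (Fin n) ℂ)) = Q
  linear_combination Q * (2 : MvPolynomial (Fin n) ℂ) * h1 - Q * (X p.1 + X p.2) * h2

/-- This is the radial part of the Casimir: in the product rule for the Laplacian, the cross term
supplies exactly the root part of the Casimir, up to a constant. -/
theorem sum_euler_euler_vdm_mul {n : ℕ} (G : MvPolynomial (Fin n) ℂ)
    (T : Fin n → Fin n → MvPolynomial (Fin n) ℂ) (N c : ℂ)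
    (hT : ∀ i j, i ≠ j → X j * T i j = X i * T j i)
    (hG : ∀ i j, i ≠ j → T i j - T j i = euler i G - euler j G)
    (hN : ∑ i, euler i G = C N * G)
    (hc : ∑ i, euler i (euler i G) + ∑ p ∈ posPairs n, (T p.1 p.2 + T p.2 p.1) = C c * G) :
    ∑ i, euler i (euler i (vdm n * G)) =
      C (c + ∑ i, (staircase n i : ℂ) ^ 2 + (n - 1) * N) * (vdm n * G) := by
  have h1 := two_mul_sum_euler_vdm_mul G T hT hG
  -- The index i is the first entry of n - 1 - i pairs and the second entry of i pairs, so it occurs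
  -- n - 1 times.
  have h2 : ∑ p ∈ posPairs n, (euler p.1 G + euler p.2 G) = C ((n - 1) * N) * G := by
    rw [Finset.sum_add_distrib, sum_posPairs_fst fun i => euler i G,
      sum_posPairs_snd fun i => euler i G, ← Finset.sum_add_distrib]
    rw [C_mul, mul_assoc, ← hN, Finset.mul_sum]
    refine Finset.sum_congr rfl fun i _ => ?_
    rw [← add_mul]
    congr 1
    have : staircase n i + (i : ℕ) + 1 = n := by
      have := i.isLt
      simp only [staircase]; omega
    have h := congrArg (Nat.cast : ℕ → MvPolynomial (Fin n) ℂ) this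
    push_cast at h
    rw [map_sub, map_natCast, map_one]
    linear_combination h
  have h3 := sum_euler_euler_vdm n
  rw [Finset.sum_add_distrib, h2] at h1
  have h4 : ∑ i, euler i (euler i (vdm n * G)) =
      vdm n * ∑ i, euler i (euler i G) + 2 * ∑ i, euler i (vdm n) * euler i G +
        (∑ i, euler i (euler i (vdm n))) * G := by
    rw [Finset.mul_sum, Finset.mul_sum, Finset.sum_mul, ← Finset.sum_add_distrib,
      ← Finset.sum_add_distrib]
    refine Finset.sum_congr rfl fun i _ => ?_
    simp only [Derivation.leibniz, map_add, smul_eq_mul]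
    ring
  rw [h4, h1, h3, map_add, map_add]
  linear_combination vdm n * hc

/-- Monomials are eigenvectors of the Laplacian, so the support of an eigenvector lies on a sphere.
-/
theorem sum_sq_eq_of_coeff_ne_zero {n : ℕ} {F : MvPolynomial (Fin n) ℂ} {c : ℂ}
    (hF : ∑ i, euler i (euler i F) = C c * F) {m : Fin n →₀ ℕ} (hm : coeff m F ≠ 0) :
    ∑ i, (m i : ℂ) ^ 2 = c := by
  have h := congrArg (coeff m) hF
  rw [coeff_sum, coeff_C_mul] at h
  simp only [coeff_euler, ← mul_assoc, ← Finset.sum_mul] at h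
  simpa only [sq] using mul_right_cancel₀ hm h

theorem coeff_vdm_mul {n : ℕ} (G : MvPolynomial (Fin n) ℂ) (m : Fin n →₀ ℕ) :
    coeff m (vdm n * G) = ∑ σ : Equiv.Perm (Fin n),
      if (∀ j, staircase n (σ j) ≤ m j) then (((Equiv.Perm.sign σ : ℤˣ) : ℤ) : ℂ) *
        coeff (m - Finsupp.equivFunOnFinite.symm fun j => staircase n (σ j)) G else 0 := by
  classical
  rw [vdm_eq_sum, Finset.sum_mul, coeff_sum]
  refine Finset.sum_congr rfl fun σ _ => ?_
  rw [coeff_monomial_mul']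
  exact if_congr Iff.rfl rfl rfl

end Alternants

/-! ### Matrix units, the Casimir operator and weighted traces. -/

section WeightBases

open MvPolynomial Module

variable {n : ℕ} {V : Type*} [AddCommGroup V] [Module ℂ V]
  (ρ : Matrix (Fin n) (Fin n) ℂ →ₗ⁅ℂ⁆ Module.End ℂ V)

/-- The operator by which the matrix unit `E_ij` acts. -/
abbrev unitOp (i j : Fin n) : Module.End ℂ V := ρ (Matrix.single i j 1)

theorem unitOp_mul_unitOp (i j k l : Fin n) :
    unitOp ρ i j * unitOp ρ k l = unitOp ρ k l * unitOp ρ i j +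
      ((if j = k then unitOp ρ i l else 0) - if l = i then unitOp ρ k j else 0) := by
  have h := LieHom.map_lie ρ (Matrix.single i j 1) (Matrix.single k l 1)
  rw [Ring.lie_def, Ring.lie_def] at h
  rw [← sub_eq_iff_eq_add', ← h, map_sub]
  congr 1
  · split_ifs with hjk
    · subst hjk; rw [Matrix.single_mul_single_same, one_mul]
    · rw [Matrix.single_mul_single_of_ne (h := hjk), map_zero]
  · split_ifs with hli
    · subst hli; rw [Matrix.single_mul_single_same, one_mul]
    · rw [Matrix.single_mul_single_of_ne (h := hli), map_zero]

theorem unitOp_mul_swap (i j : Fin n) :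
    unitOp ρ i j * unitOp ρ j i = unitOp ρ j i * unitOp ρ i j + (unitOp ρ i i - unitOp ρ j j) := by
  rw [unitOp_mul_unitOp]
  simp

theorem sum_unitOp_diag : ∑ i, unitOp ρ i i = ρ 1 := by
  rw [← map_sum, ← Matrix.sum_single_one]

theorem map_eq_sum_unitOp (A : Matrix (Fin n) (Fin n) ℂ) :
    ρ A = ∑ i, ∑ j, A i j • unitOp ρ i j := by
  conv_lhs => rw [Matrix.matrix_eq_sum_single A]
  simp only [map_sum]
  refine Finset.sum_congr rfl fun i _ => Finset.sum_congr rfl fun j _ => ?_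
  rw [← map_smul, Matrix.smul_single, smul_eq_mul, mul_one]

/-- A subrepresentation for `su(n)` is stable under all complex matrices as soon as the identity
matrix acts by a scalar. -/
theorem IsSubrep.apply_mem {ρ : Matrix (Fin n) (Fin n) ℂ →ₗ⁅ℂ⁆ Module.End ℂ V} (hn : n ≠ 0) {N : ℂ}
    (hN : ρ 1 = N • 1) {W : Submodule ℂ V} (hW : IsSubrep ρ W) (A : Matrix (Fin n) (Fin n) ℂ) {v : V}
    (hv : v ∈ W) : ρ A v ∈ W := by
  have hn' : (n : ℂ) ≠ 0 := Nat.cast_ne_zero.mpr hn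
  -- Removing a scalar makes the matrix traceless; a traceless B is a complex combination of B - B*
  -- and i(B + B*), both in `su n`.
  set a : ℂ := A.trace / n with ha
  set B := A - a • 1 with hB
  have hBt : B.trace = 0 := by
    rw [hB, Matrix.trace_sub, Matrix.trace_smul, Matrix.trace_one, Fintype.card_fin, smul_eq_mul, ha]
    field_simp
    simp
  have h1 : B - B.conjTranspose ∈ su n := by
    refine ⟨?_, ?_⟩
    · rw [Matrix.conjTranspose_sub, Matrix.conjTranspose_conjTranspose, neg_sub]
    · rw [Matrix.trace_sub, Matrix.trace_conjTranspose, hBt, star_zero, sub_zero]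
  have h2 : Complex.I • (B + B.conjTranspose) ∈ su n := by
    refine ⟨?_, ?_⟩
    · rw [Matrix.conjTranspose_smul, Matrix.conjTranspose_add, Matrix.conjTranspose_conjTranspose,
        ← neg_smul, add_comm]
      simp
    · rw [Matrix.trace_smul, Matrix.trace_add, Matrix.trace_conjTranspose, hBt, star_zero, add_zero,
        smul_zero]
  have h3 : A = (2⁻¹ : ℂ) • (B - B.conjTranspose) +
      (-(2⁻¹ * Complex.I)) • (Complex.I • (B + B.conjTranspose)) + a • 1 := by
    rw [smul_smul]
    have : -(2⁻¹ * Complex.I) * Complex.I = 2⁻¹ := by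
      rw [neg_mul, mul_assoc, Complex.I_mul_I]; ring
    rw [this, ← smul_add, sub_add_add_cancel, ← two_smul ℂ B, smul_smul]
    norm_num [hB]
  rw [h3, map_add, map_add, map_smul ρ (2⁻¹ : ℂ), map_smul ρ (-(2⁻¹ * Complex.I)), map_smul ρ a, hN]
  simp only [LinearMap.add_apply, LinearMap.smul_apply, Module.End.one_apply]
  exact W.add_mem (W.add_mem (W.smul_mem _ (hW _ h1 v hv)) (W.smul_mem _ (hW _ h2 v hv)))
    (W.smul_mem _ (W.smul_mem _ hv))

/-- The quadratic Casimir operator. -/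
def casimir : Module.End ℂ V := ∑ i, ∑ j, unitOp ρ i j * unitOp ρ j i

/-- Commuting E_kl past both factors leaves four sums. After summation over i and j, the first
cancels the fourth and the second cancels the third. -/
theorem casimir_mul_unitOp (k l : Fin n) : casimir ρ * unitOp ρ k l = unitOp ρ k l * casimir ρ := by
  have h : ∀ i j, unitOp ρ i j * unitOp ρ j i * unitOp ρ k l =
      unitOp ρ k l * (unitOp ρ i j * unitOp ρ j i) +
      (((if j = k then unitOp ρ i l * unitOp ρ j i else 0) -
        if l = i then unitOp ρ k j * unitOp ρ j i else 0) +
      ((if i = k then unitOp ρ i j * unitOp ρ j l else 0) -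
        if l = j then unitOp ρ i j * unitOp ρ k i else 0)) := by
    intro i j
    rw [mul_assoc, unitOp_mul_unitOp ρ j i k l, mul_add, ← mul_assoc, unitOp_mul_unitOp ρ i j k l,
      add_mul, mul_assoc, mul_sub, sub_mul]
    simp only [ite_mul, mul_ite, zero_mul, mul_zero]
    abel
  simp only [casimir, Finset.sum_mul, Finset.mul_sum, h, Finset.sum_add_distrib,
    Finset.sum_sub_distrib]
  simp

theorem casimir_eq : casimir ρ = ∑ i, unitOp ρ i i * unitOp ρ i i +
    ∑ p ∈ posPairs n, (unitOp ρ p.1 p.2 * unitOp ρ p.2 p.1 +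
      unitOp ρ p.2 p.1 * unitOp ρ p.1 p.2) := by
  have h : ∀ i j, unitOp ρ i j * unitOp ρ j i =
      ((if i = j then unitOp ρ i i * unitOp ρ i i else 0) +
        if i < j then unitOp ρ i j * unitOp ρ j i else 0) +
        if j < i then unitOp ρ i j * unitOp ρ j i else 0 := by
    intro i j
    rcases lt_trichotomy i j with h | h | h
    · simp [h, h.ne, h.not_gt]
    · subst h; simp
    · simp [h, h.ne', h.not_gt]
  have h1 : casimir ρ = ∑ i, ∑ j, (((if i = j then unitOp ρ i i * unitOp ρ i i else 0) +
        if i < j then unitOp ρ i j * unitOp ρ j i else 0) +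
        if j < i then unitOp ρ i j * unitOp ρ j i else 0) :=
    Finset.sum_congr rfl fun i _ => Finset.sum_congr rfl fun j _ => h i j
  rw [h1]
  simp only [Finset.sum_add_distrib]
  rw [Finset.sum_filter, Finset.sum_filter, Fintype.sum_prod_type, Fintype.sum_prod_type, add_assoc]
  congr 1
  · simp
  · congr 1
    exact Finset.sum_comm

variable {ι : Type*} [Fintype ι]

/-- The vector `b f` has weight `wt f`. -/
def IsWeightBasis (b : Basis ι ℂ V) (wt : ι → Fin n →₀ ℕ) : Prop :=
  ∀ f i, unitOp ρ i i (b f) = (wt f i : ℂ) • b f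

/-- The generating function `∑ T_ff x ^ (wt f)` of the diagonal entries of an operator. -/
def traceGen (b : Basis ι ℂ V) (wt : ι → Fin n →₀ ℕ) (T : Module.End ℂ V) :
    MvPolynomial (Fin n) ℂ :=
  ∑ f, monomial (wt f) (b.repr (T (b f)) f)

section

variable {ρ} {b : Basis ι ℂ V} {wt : ι → Fin n →₀ ℕ}

theorem IsWeightBasis.repr_diag (hb : IsWeightBasis ρ b wt) (i : Fin n) (v : V) (f : ι) :
    b.repr (unitOp ρ i i v) f = wt f i * b.repr v f := by
  conv_lhs => rw [← b.sum_repr v, map_sum]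
  simp only [map_smul, hb _ _, map_sum, Finsupp.coe_finsetSum, Finset.sum_apply, Basis.repr_self,
    Finsupp.smul_apply, smul_eq_mul]
  rw [Finset.sum_eq_single f]
  · simp [mul_comm]
  · intro g _ hg
    simp [Finsupp.single_eq_of_ne hg.symm]
  · simp

theorem IsWeightBasis.wt_eq (hb : IsWeightBasis ρ b wt) {i : Fin n} {v : V} {c : ℂ}
    (hv : unitOp ρ i i v = c • v) {f : ι} (hf : b.repr v f ≠ 0) : (wt f i : ℂ) = c := by
  have h := hb.repr_diag i v f
  rw [hv, map_smul, Finsupp.smul_apply, smul_eq_mul] at h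
  exact (mul_right_cancel₀ hf h).symm

/-- E_ij changes weights by e_i - e_j; the additive form avoids subtraction of natural numbers. -/
theorem IsWeightBasis.wt_shift (hb : IsWeightBasis ρ b wt) {i j : Fin n} {f g : ι}
    (h : b.repr (unitOp ρ i j (b f)) g ≠ 0) :
    wt g + Finsupp.single j 1 = wt f + Finsupp.single i 1 := by
  ext k
  have hk : unitOp ρ k k (unitOp ρ i j (b f)) =
      ((wt f k : ℂ) + ((if k = i then 1 else 0) - if k = j then 1 else 0)) •
        unitOp ρ i j (b f) := by
    have := LinearMap.congr_fun (unitOp_mul_unitOp ρ k k i j) (b f)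
    simp only [Module.End.mul_apply, LinearMap.add_apply, LinearMap.sub_apply, hb f k, map_smul]
      at this
    rw [this, add_smul, sub_smul]
    congr 2
    · split_ifs with hki
      · subst hki; simp
      · simp
    · by_cases hkj : k = j
      · subst hkj; simp
      · simp [hkj, Ne.symm hkj]
  have hw := hb.wt_eq hk h
  simp only [Finsupp.add_apply, Finsupp.single_apply, eq_comm (b := k)]
  have : ((wt g k + if k = j then 1 else 0 : ℕ) : ℂ) = (wt f k + if k = i then 1 else 0 : ℕ) := by
    push_cast
    rw [hw]
    ring
  exact_mod_cast this

theorem traceGen_add (T S : Module.End ℂ V) :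
    traceGen b wt (T + S) = traceGen b wt T + traceGen b wt S := by
  simp [traceGen, Finset.sum_add_distrib]

theorem traceGen_sub (T S : Module.End ℂ V) :
    traceGen b wt (T - S) = traceGen b wt T - traceGen b wt S := by
  simp [traceGen, Finset.sum_sub_distrib]

theorem traceGen_smul (c : ℂ) (T : Module.End ℂ V) :
    traceGen b wt (c • T) = C c * traceGen b wt T := by
  simp [traceGen, Finset.mul_sum, C_mul_monomial]

theorem traceGen_sum {κ : Type*} (s : Finset κ) (T : κ → Module.End ℂ V) :
    traceGen b wt (∑ a ∈ s, T a) = ∑ a ∈ s, traceGen b wt (T a) := by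
  classical
  induction s using Finset.induction_on with
  | empty => simp [traceGen]
  | insert a s ha ih => rw [Finset.sum_insert ha, Finset.sum_insert ha, traceGen_add, ih]

theorem IsWeightBasis.traceGen_diag_mul (hb : IsWeightBasis ρ b wt) (i : Fin n)
    (T : Module.End ℂ V) : traceGen b wt (unitOp ρ i i * T) = euler i (traceGen b wt T) := by
  simp only [traceGen, map_sum, euler_monomial, Module.End.mul_apply, hb.repr_diag]

/-- Cyclicity of the trace, graded by weight: the two orders record the same product of entries at
weights that differ by e_i - e_j, which the factors `X j` and `X i` compensate. -/
theorem IsWeightBasis.traceGen_mul_comm (hb : IsWeightBasis ρ b wt) (i j : Fin n)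
    (T : Module.End ℂ V) :
    X j * traceGen b wt (unitOp ρ i j * T) = X i * traceGen b wt (T * unitOp ρ i j) := by
  have h1 : ∀ (S R : Module.End ℂ V) (f : ι), b.repr ((S * R) (b f)) f =
      ∑ g, b.repr (S (b g)) f * b.repr (R (b f)) g := by
    intro S R f
    rw [Module.End.mul_apply]
    conv_lhs => rw [← b.sum_repr (R (b f)), map_sum, map_sum]
    simp [mul_comm]
  simp only [traceGen, h1, Finset.mul_sum, map_sum]
  rw [Finset.sum_comm]
  refine Finset.sum_congr rfl fun g _ => Finset.sum_congr rfl fun f _ => ?_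
  rw [mul_comm (b.repr (T (b f)) g)]
  by_cases h : b.repr (unitOp ρ i j (b g)) f = 0
  · simp [h]
  · rw [X, X, monomial_mul, monomial_mul, add_comm, hb.wt_shift h, add_comm]

end

end WeightBases

/-! ### Highest-weight vectors and the coefficient form of the Weyl character formula. -/

section HighestWeights

open MvPolynomial Module

variable {n : ℕ} {V : Type*} [AddCommGroup V] [Module ℂ V]
  {ρ : Matrix (Fin n) (Fin n) ℂ →ₗ⁅ℂ⁆ Module.End ℂ V}
  {ι : Type*} [Fintype ι] {b : Basis ι ℂ V} {wt : ι → Fin n →₀ ℕ}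

/-- `v` is annihilated by the positive root vectors and `E_ii` acts on it by `ν i`. -/
def IsHighestWeightVector (ρ : Matrix (Fin n) (Fin n) ℂ →ₗ⁅ℂ⁆ Module.End ℂ V) (ν : Fin n →₀ ℕ)
    (v : V) : Prop :=
  (∀ i j, i < j → unitOp ρ i j v = 0) ∧ ∀ i, unitOp ρ i i v = (ν i : ℂ) • v

/-- The pairing `∑ w i * μ i`. -/
def pairing (w : Fin n → ℕ) (μ : Fin n →₀ ℕ) : ℕ := ∑ i, w i * μ i

theorem pairing_add (w : Fin n → ℕ) (μ κ : Fin n →₀ ℕ) :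
    pairing w (μ + κ) = pairing w μ + pairing w κ := by
  simp [pairing, mul_add, Finset.sum_add_distrib]

theorem pairing_single (w : Fin n → ℕ) (i : Fin n) : pairing w (Finsupp.single i 1) = w i := by
  simp [pairing, Finsupp.single_apply]

/-- A submodule stable under lowering operators that contains a highest-weight vector of an
irreducible subrepresentation contains this subrepresentation. -/
theorem IsIrredSubrep.le_of_lowering {W : Submodule ℂ V} (hW : IsIrredSubrep ρ W)
    (hWgl : ∀ A, ∀ u ∈ W, ρ A u ∈ W) {ν : Fin n →₀ ℕ} {v : V} (hvW : v ∈ W) (hv0 : v ≠ 0)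
    (hv : IsHighestWeightVector ρ ν v) {U : Submodule ℂ V} (hvU : v ∈ U)
    (hU : ∀ i j, j < i → ∀ u ∈ U, unitOp ρ i j u ∈ U) : W ≤ U := by
  let S : Set (Submodule ℂ V) := {U | v ∈ U ∧ ∀ i j, j < i → ∀ u ∈ U, unitOp ρ i j u ∈ U}
  -- The smallest lowering-stable submodule containing v. Once it is known to be stable under all
  -- matrix units, irreducibility puts W inside it.
  let U₀ : Submodule ℂ V := sInf S
  have hU₀U : U₀ ≤ U := sInf_le ⟨hvU, hU⟩
  have hvU₀ : v ∈ U₀ := by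
    rw [Submodule.mem_sInf]
    exact fun U' hU' => hU'.1
  have hlow : ∀ i j, j < i → ∀ u ∈ U₀, unitOp ρ i j u ∈ U₀ := by
    intro i j hij u hu
    rw [Submodule.mem_sInf] at hu ⊢
    exact fun U' hU' => hU'.2 i j hij u (hu U' hU')
  -- The vectors that all matrix units keep in `U₀`. By the commutation relations `U₁` also belongs
  -- to `S`, so minimality gives `U₀ ≤ U₁`, which is the stability of `U₀`.
  let U₁ : Submodule ℂ V :=
    { carrier := {u | u ∈ U₀ ∧ ∀ k l, unitOp ρ k l u ∈ U₀}
      zero_mem' := ⟨U₀.zero_mem, fun k l => by simp⟩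
      add_mem' := fun {x y} hx hy => ⟨U₀.add_mem hx.1 hy.1, fun k l => by
        rw [map_add]; exact U₀.add_mem (hx.2 k l) (hy.2 k l)⟩
      smul_mem' := fun c x hx => ⟨U₀.smul_mem c hx.1, fun k l => by
        rw [map_smul]; exact U₀.smul_mem c (hx.2 k l)⟩ }
  have hU₁ : U₀ ≤ U₁ := by
    refine sInf_le ⟨⟨hvU₀, fun k l => ?_⟩, fun i j hij u hu => ⟨hlow i j hij u hu.1, fun k l => ?_⟩⟩
    · rcases lt_trichotomy k l with h | h | h
      · rw [hv.1 k l h]; exact U₀.zero_mem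
      · subst h; rw [hv.2]; exact U₀.smul_mem _ hvU₀
      · exact hlow k l h v hvU₀
    · have h := LinearMap.congr_fun (unitOp_mul_unitOp ρ k l i j) u
      simp only [Module.End.mul_apply, LinearMap.add_apply, LinearMap.sub_apply] at h
      rw [h]
      refine U₀.add_mem (hlow i j hij _ (hu.2 k l)) (U₀.sub_mem ?_ ?_)
      · split_ifs
        · exact hu.2 _ _
        · exact U₀.zero_mem
      · split_ifs
        · exact hu.2 _ _
        · exact U₀.zero_mem
  have hgl : ∀ A, ∀ u ∈ U₀, ρ A u ∈ U₀ := by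
    intro A u hu
    rw [map_eq_sum_unitOp]
    simp only [LinearMap.sum_apply, LinearMap.smul_apply]
    exact U₀.sum_mem fun k _ => U₀.sum_mem fun l _ => U₀.smul_mem _ ((hU₁ hu).2 k l)
  rcases hW.2.2 (W ⊓ U₀) inf_le_left
    (fun A _ u hu => ⟨hWgl A u hu.1, hgl A u hu.2⟩) with h | h
  · exact absurd ((Submodule.eq_bot_iff _).mp h v ⟨hvW, hvU₀⟩) hv0
  · exact (inf_eq_left.mp h).trans hU₀U

/-- In an irreducible subrepresentation with a highest-weight vector `v` of weight `ν`, a weight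
vector whose weight is not lower than `ν` is a multiple of `v`. -/
theorem IsIrredSubrep.exists_eq_smul (hb : IsWeightBasis ρ b wt) {W : Submodule ℂ V}
    (hW : IsIrredSubrep ρ W)
    (hWgl : ∀ A, ∀ u ∈ W, ρ A u ∈ W) {ν : Fin n →₀ ℕ} {v : V} (hvW : v ∈ W) (hv0 : v ≠ 0)
    (hv : IsHighestWeightVector ρ ν v) {w : Fin n → ℕ} (hw : StrictAnti w) {μ : Fin n →₀ ℕ} {u : V}
    (huW : u ∈ W) (hu : ∀ i, unitOp ρ i i u = (μ i : ℂ) • u)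
    (hμ : pairing w ν ≤ pairing w μ) : ∃ c : ℂ, u = c • v := by
  have wt_eq : ∀ {κ : Fin n →₀ ℕ} {x : V}, (∀ i, unitOp ρ i i x = (κ i : ℂ) • x) →
      ∀ f, b.repr x f ≠ 0 → wt f = κ := by
    intro κ x hx f hf
    ext i
    exact_mod_cast hb.wt_eq (hx i) hf
  -- The vectors whose coordinates at weights not below ν, as measured by w, are proportional to
  -- those of v.
  let B : Submodule ℂ V :=
    { carrier := {x | ∃ c : ℂ, ∀ f, pairing w ν ≤ pairing w (wt f) →
        b.repr x f = c * b.repr v f}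
      zero_mem' := ⟨0, fun f _ => by simp⟩
      add_mem' := fun {x y} ⟨c, hx⟩ ⟨d, hy⟩ => ⟨c + d, fun f hf => by
        rw [map_add, Finsupp.add_apply, hx f hf, hy f hf, add_mul]⟩
      smul_mem' := fun a x ⟨c, hx⟩ => ⟨a * c, fun f hf => by
        rw [map_smul, Finsupp.smul_apply, hx f hf, smul_eq_mul, mul_assoc]⟩ }
  have hWB : W ≤ B := by
    refine hW.le_of_lowering hWgl hvW hv0 hv ⟨1, fun f _ => (one_mul _).symm⟩ ?_
    rintro i j hij x ⟨c, hx⟩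
    -- Lowering strictly decreases the pairing, so a contribution at f comes from a g with pairing
    -- strictly above that of ν. There v has no coordinate, hence neither has x.
    refine ⟨0, fun f hf => ?_⟩
    conv_lhs => rw [← b.sum_repr x, map_sum, map_sum]
    simp only [map_smul, Finsupp.coe_finsetSum, Finset.sum_apply, Finsupp.smul_apply, smul_eq_mul,
      zero_mul]
    refine Finset.sum_eq_zero fun g _ => ?_
    by_contra hne
    have hg := hb.wt_shift (right_ne_zero_of_mul hne)
    have hp := congrArg (pairing w) hg
    rw [pairing_add, pairing_add, pairing_single, pairing_single] at hp
    have hlt := hw hij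
    have hxg := left_ne_zero_of_mul hne
    rw [hx g (by omega)] at hxg
    have := wt_eq hv.2 g (right_ne_zero_of_mul hxg)
    rw [this] at hp
    omega
  obtain ⟨c, hc⟩ := hWB huW
  refine ⟨c, b.ext_elem fun f => ?_⟩
  rw [map_smul, Finsupp.smul_apply, smul_eq_mul]
  by_cases hf : pairing w ν ≤ pairing w (wt f)
  · exact hc f hf
  · have h1 : b.repr u f = 0 := by
      by_contra h
      exact hf (by rw [wt_eq hu f h]; exact hμ)
    have h2 : b.repr v f = 0 := by
      by_contra h
      exact hf (by rw [wt_eq hv.2 f h])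
    rw [h1, h2, mul_zero]

/-- For i < j, E_ji E_ij kills v, and E_ij E_ji acts on it as the commutator E_ii - E_jj. -/
theorem IsHighestWeightVector.casimir_apply {ν : Fin n →₀ ℕ} {v : V}
    (hv : IsHighestWeightVector ρ ν v) :
    casimir ρ v = (∑ i, (ν i : ℂ) ^ 2 + ∑ p ∈ posPairs n, ((ν p.1 : ℂ) - ν p.2)) • v := by
  rw [casimir_eq, LinearMap.add_apply, LinearMap.sum_apply, LinearMap.sum_apply, add_smul,
    Finset.sum_smul, Finset.sum_smul]
  congr 1
  · refine Finset.sum_congr rfl fun i _ => ?_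
    rw [Module.End.mul_apply, hv.2, map_smul, hv.2, smul_smul, sq]
  · refine Finset.sum_congr rfl fun p hp => ?_
    have hlt : p.1 < p.2 := by simpa using hp
    rw [unitOp_mul_swap]
    simp only [LinearMap.add_apply, LinearMap.sub_apply, Module.End.mul_apply, hv.1 _ _ hlt,
      map_zero, hv.2, sub_smul]
    abel

/-- Completing the square: the root sum contributes (n - 1 - 2i) ν_i, and adding (n - 1) ν_i gives 2
ν_i δ_i. -/
theorem highestWeight_const {n : ℕ} (ν : Fin n →₀ ℕ) :
    (∑ i, (ν i : ℂ) ^ 2 + ∑ p ∈ posPairs n, ((ν p.1 : ℂ) - ν p.2)) +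
        ∑ i, (staircase n i : ℂ) ^ 2 + (n - 1) * ∑ i, (ν i : ℂ) =
      ∑ i, ((ν i : ℂ) + staircase n i) ^ 2 := by
  rw [Finset.sum_sub_distrib, sum_posPairs_fst fun i => (ν i : ℂ),
    sum_posPairs_snd fun i => (ν i : ℂ), ← Finset.sum_sub_distrib, ← Finset.sum_add_distrib,
    ← Finset.sum_add_distrib, Finset.mul_sum, ← Finset.sum_add_distrib]
  refine Finset.sum_congr rfl fun i _ => ?_
  have : staircase n i + (i : ℕ) + 1 = n := by
    have := i.isLt
    simp only [staircase]; omega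
  have h := congrArg (Nat.cast : ℕ → ℂ) this
  push_cast at h
  linear_combination -(ν i : ℂ) * h

/-- Rearrangement inequality: w and the staircase are ordered alike. It applies to the exponents μ
that meet a Vandermonde term to give x^(κ+δ). -/
theorem pairing_le_of_add_comp_perm {n : ℕ} {w : Fin n → ℕ} (hw : StrictAnti w)
    {μ κ : Fin n →₀ ℕ} {σ : Equiv.Perm (Fin n)}
    (h : ∀ i, μ i + staircase n (σ i) = κ i + staircase n i) : pairing w κ ≤ pairing w μ := by
  have h1 : ∑ i, w i * staircase n (σ i) ≤ ∑ i, w i * staircase n i :=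
    (hw.antitone.monovary (staircase_strictAnti n).antitone).sum_mul_comp_perm_le_sum_mul
  have h2 : ∑ i, w i * (μ i + staircase n (σ i)) = ∑ i, w i * (κ i + staircase n i) :=
    Finset.sum_congr rfl fun i _ => by rw [h]
  simp only [mul_add, Finset.sum_add_distrib] at h2
  simp only [pairing]
  omega

/-- |ν - κ|² = |ν+δ|² - |κ+δ|² - 2⟨κ+δ, ν - κ⟩ ≤ 0. -/
theorem eq_of_pairing_le_of_sum_sq {n : ℕ} {κ ν : Fin n →₀ ℕ}
    (h1 : pairing (fun i => κ i + staircase n i) κ ≤ pairing (fun i => κ i + staircase n i) ν)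
    (h2 : ∑ i, (κ i + staircase n i) ^ 2 = ∑ i, (ν i + staircase n i) ^ 2) : ν = κ := by
  have h3 : ∑ i, ((ν i : ℤ) - κ i) ^ 2 ≤ 0 := by
    zify [pairing] at h1 h2
    have : ∑ i, ((ν i : ℤ) - κ i) ^ 2 =
        ∑ i, ((ν i : ℤ) + staircase n i) ^ 2 - ∑ i, ((κ i : ℤ) + staircase n i) ^ 2 -
          2 * (∑ i, ((κ i : ℤ) + staircase n i) * ν i - ∑ i, ((κ i : ℤ) + staircase n i) * κ i) := by
      rw [← Finset.sum_sub_distrib, ← Finset.sum_sub_distrib, Finset.mul_sum,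
        ← Finset.sum_sub_distrib]
      exact Finset.sum_congr rfl fun i _ => by ring
    rw [this, h2]
    linarith
  have h4 := (Finset.sum_eq_zero_iff_of_nonneg fun i _ => sq_nonneg ((ν i : ℤ) - κ i)).mp
    (le_antisymm h3 (Finset.sum_nonneg fun i _ => sq_nonneg _))
  ext i
  have := pow_eq_zero_iff (two_ne_zero) |>.mp (h4 i (Finset.mem_univ i))
  omega

omit [Fintype ι] in
theorem map_one_of_degree {N : ℕ} (hb : IsWeightBasis ρ b wt) (hN : ∀ f, (wt f).degree = N) :
    ρ 1 = (N : ℂ) • 1 := by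
  rw [← sum_unitOp_diag]
  refine b.ext fun f => ?_
  rw [LinearMap.sum_apply, LinearMap.smul_apply, Module.End.one_apply, ← hN f]
  simp only [hb f, ← Finset.sum_smul, Finsupp.degree_eq_sum, Nat.cast_sum]

section Projection

variable {N : ℕ} {W : Submodule ℂ V} {p : Module.End ℂ V}

/-- An irreducible subrepresentation has a highest-weight vector whose weight is maximal for the
pairing with a given strictly decreasing sequence. -/
theorem exists_isHighestWeightVector (hb : IsWeightBasis ρ b wt) (hW0 : W ≠ ⊥)
    (hpW : ∀ v, p v ∈ W) (hp : ∀ v ∈ W, p v = v) (hcomm : ∀ i j, p * unitOp ρ i j = unitOp ρ i j * p)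
    {w : Fin n → ℕ} (hw : StrictAnti w) :
    ∃ ν v, v ∈ W ∧ v ≠ 0 ∧ IsHighestWeightVector ρ ν v ∧
      ∀ f, p (b f) ≠ 0 → pairing w (wt f) ≤ pairing w ν := by
  classical
  have hne : (Finset.univ.filter fun f => p (b f) ≠ 0).Nonempty := by
    by_contra h
    rw [Finset.not_nonempty_iff_eq_empty, Finset.filter_eq_empty_iff] at h
    refine hW0 ((Submodule.eq_bot_iff _).mpr fun x hx => ?_)
    rw [← hp x hx, b.ext (f₁ := p) (f₂ := 0) fun f => by simpa using h (Finset.mem_univ f)]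
    rfl
  -- Raising operators strictly increase the pairing, and p kills basis vectors beyond the maximum,
  -- so `p (b f)` is a highest-weight vector.
  obtain ⟨f, hf, hmax⟩ := Finset.exists_max_image _ (fun f => pairing w (wt f)) hne
  simp only [Finset.mem_filter, Finset.mem_univ, true_and] at hf hmax
  refine ⟨wt f, p (b f), hpW _, hf, ⟨fun i j hij => ?_, fun i => ?_⟩, hmax⟩
  · rw [← Module.End.mul_apply, ← hcomm, Module.End.mul_apply, ← b.sum_repr (unitOp ρ i j (b f)),
      map_sum]
    refine Finset.sum_eq_zero fun g _ => ?_
    rw [map_smul, smul_eq_zero]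
    by_contra! h
    have hp := congrArg (pairing w) (hb.wt_shift h.1)
    rw [pairing_add, pairing_add, pairing_single, pairing_single] at hp
    have := hmax g h.2
    have := hw hij
    omega
  · rw [← Module.End.mul_apply, ← hcomm, Module.End.mul_apply, hb, map_smul]

/-- With T_ij the weighted trace of E_ij E_ji p, `hT` is graded cyclicity together with equivariance
of p, and `hG` is the relation [E_ij, E_ji] = E_ii - E_jj. -/
theorem sum_euler_euler_vdm_mul_traceGen (hb : IsWeightBasis ρ b wt)
    (hN : ∀ f, (wt f).degree = N) (hcomm : ∀ i j, p * unitOp ρ i j = unitOp ρ i j * p) {c : ℂ}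
    (hc : casimir ρ * p = c • p) :
    ∑ i, euler i (euler i (vdm n * traceGen b wt p)) =
      C (c + ∑ i, (staircase n i : ℂ) ^ 2 + (n - 1) * N) * (vdm n * traceGen b wt p) := by
  refine sum_euler_euler_vdm_mul _ (fun i j => traceGen b wt (unitOp ρ i j * unitOp ρ j i * p)) _ _
    (fun i j _ => ?_) (fun i j _ => ?_) ?_ ?_
  · rw [mul_assoc, hb.traceGen_mul_comm, mul_assoc, hcomm, mul_assoc]
  · rw [unitOp_mul_swap, add_mul, sub_mul, traceGen_add, traceGen_sub, hb.traceGen_diag_mul,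
      hb.traceGen_diag_mul]
    ring
  · simp only [← hb.traceGen_diag_mul]
    rw [← traceGen_sum, ← Finset.sum_mul, sum_unitOp_diag, map_one_of_degree hb hN, smul_mul_assoc,
      one_mul, traceGen_smul]
  · rw [← traceGen_smul, ← hc, casimir_eq]
    simp only [add_mul, Finset.sum_mul, traceGen_add, traceGen_sum, mul_assoc,
      hb.traceGen_diag_mul]

theorem coeff_traceGen (b : Basis ι ℂ V) (wt : ι → Fin n →₀ ℕ) (p : Module.End ℂ V)
    (μ : Fin n →₀ ℕ) :
    coeff μ (traceGen b wt p) = ∑ f, if wt f = μ then b.repr (p (b f)) f else 0 := by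
  classical
  rw [traceGen, coeff_sum]
  exact Finset.sum_congr rfl fun f _ => by rw [coeff_monomial]

omit [Fintype ι] in
-- Weights of `su n` fix only the differences of the entries; since the identity matrix acts by N =
-- |λ|, summing the differences over j recovers each entry.
theorem hasHighestWeight_iff (hn : n ≠ 0) (hb : IsWeightBasis ρ b wt)
    (hN : ∀ f, (wt f).degree = N) {lam : Fin n →₀ ℕ} (hlam : lam.degree = N) :
    HasHighestWeight ρ W (fun i => lam i) ↔ ∃ v ∈ W, v ≠ 0 ∧ IsHighestWeightVector ρ lam v := by
  constructor
  · rintro ⟨v, hvW, hv0, h1, h2⟩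
    refine ⟨v, hvW, hv0, h1, fun i => ?_⟩
    have h3 : ∑ j, ρ (Matrix.single i i 1 - Matrix.single j j 1) v =
        (n : ℂ) • unitOp ρ i i v - (N : ℂ) • v := by
      simp only [map_sub, LinearMap.sub_apply, Finset.sum_sub_distrib]
      rw [← LinearMap.sum_apply, ← LinearMap.sum_apply, sum_unitOp_diag, map_one_of_degree hb hN]
      simp [Nat.cast_smul_eq_nsmul]
    have h4 : ∑ j, ρ (Matrix.single i i 1 - Matrix.single j j 1) v =
        ((n : ℂ) * lam i - N) • v := by
      rw [Finset.sum_congr rfl fun j _ => h2 i j, ← Finset.sum_smul]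
      congr 1
      push_cast
      rw [Finset.sum_sub_distrib, ← hlam, Finsupp.degree_eq_sum]
      simp
    rw [h4, sub_smul, sub_left_inj, mul_smul] at h3
    exact (smul_right_injective V (Nat.cast_ne_zero.mpr hn : (n : ℂ) ≠ 0) h3).symm
  · rintro ⟨v, hvW, hv0, h1, h2⟩
    refine ⟨v, hvW, hv0, h1, fun i j => ?_⟩
    rw [map_sub, LinearMap.sub_apply, h2, h2, ← sub_smul]
    simp

/-- The Weyl character formula, read off at the strictly dominant exponents. -/
theorem coeff_vdm_mul_traceGen (hn : n ≠ 0) (hb : IsWeightBasis ρ b wt)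
    (hN : ∀ f, (wt f).degree = N) (hW : IsIrredSubrep ρ W)
    (hpW : ∀ v, p v ∈ W) (hp : ∀ v ∈ W, p v = v) (hcomm : ∀ i j, p * unitOp ρ i j = unitOp ρ i j * p)
    {lam : Fin n →₀ ℕ} (hanti : Antitone lam) (hlam : lam.degree = N) [Decidable
      (HasHighestWeight ρ W fun i => lam i)] :
    coeff (lam + Finsupp.equivFunOnFinite.symm (staircase n)) (vdm n * traceGen b wt p) =
      if HasHighestWeight ρ W (fun i => lam i) then 1 else 0 := by
  classical
  -- Measuring weights by λ + δ itself makes the maximality of ν the inequality needed in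
  -- `eq_of_pairing_le_of_sum_sq`.
  set w : Fin n → ℕ := fun i => lam i + staircase n i with hwdef
  have hw : StrictAnti w := fun i j hij =>
    add_lt_add_of_le_of_lt (hanti hij.le) (staircase_strictAnti n hij)
  have hWgl : ∀ A, ∀ u ∈ W, ρ A u ∈ W := fun A u hu =>
    hW.1.apply_mem hn (map_one_of_degree hb hN) A hu
  obtain ⟨ν, v, hvW, hv0, hv, hmax⟩ := exists_isHighestWeightVector hb hW.2.1 hpW hp hcomm hw
  have wt_eq : ∀ {κ : Fin n →₀ ℕ} {x : V}, (∀ i, unitOp ρ i i x = (κ i : ℂ) • x) →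
      ∀ f, b.repr x f ≠ 0 → wt f = κ := by
    intro κ x hx f hf
    ext i
    exact_mod_cast hb.wt_eq (hx i) hf
  have weight_unique : ∀ {κ κ' : Fin n →₀ ℕ} {x : V}, x ≠ 0 →
      (∀ i, unitOp ρ i i x = (κ i : ℂ) • x) → (∀ i, unitOp ρ i i x = (κ' i : ℂ) • x) → κ = κ' := by
    intro κ κ' x hx h h'
    ext i
    exact_mod_cast smul_left_injective ℂ hx ((h i).symm.trans (h' i))
  have hpwt : ∀ f i, unitOp ρ i i (p (b f)) = (wt f i : ℂ) • p (b f) := by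
    intro f i
    rw [← Module.End.mul_apply, ← hcomm, Module.End.mul_apply, hb, map_smul]
  have hνdeg : ν.degree = N := by
    obtain ⟨f, hf⟩ : ∃ f, b.repr v f ≠ 0 := by
      by_contra! h
      exact hv0 (b.ext_elem fun f => by simpa using h f)
    rw [← wt_eq hv.2 f hf, hN]
  have hiff : HasHighestWeight ρ W (fun i => lam i) ↔ ν = lam := by
    rw [hasHighestWeight_iff hn hb hN hlam]
    constructor
    · rintro ⟨v', hvW', hv0', hv'⟩
      have hle : pairing w lam ≤ pairing w ν := by
        by_contra hlt
        refine hv0' ?_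
        rw [← hp v' hvW', ← b.sum_repr v', map_sum]
        refine Finset.sum_eq_zero fun f _ => ?_
        rw [map_smul, smul_eq_zero]
        by_contra! h
        exact hlt (wt_eq hv'.2 f h.1 ▸ hmax f h.2)
      obtain ⟨c, rfl⟩ := hW.exists_eq_smul hb hWgl hvW' hv0' hv' hw hvW hv.2 hle
      refine weight_unique hv0 hv.2 fun i => ?_
      rw [map_smul, hv'.2, smul_comm]
    · rintro rfl
      exact ⟨v, hvW, hv0, hv⟩
  have hterm : ∀ {μ : Fin n →₀ ℕ}, coeff μ (traceGen b wt p) ≠ 0 →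
      pairing w μ ≤ pairing w ν ∧ (pairing w ν ≤ pairing w μ → μ = ν) := by
    intro μ h
    rw [coeff_traceGen] at h
    obtain ⟨f, -, hf⟩ := Finset.exists_ne_zero_of_sum_ne_zero h
    obtain ⟨rfl, hf⟩ : wt f = μ ∧ b.repr (p (b f)) f ≠ 0 := by simpa using hf
    have hpf : p (b f) ≠ 0 := fun h0 => hf (by rw [h0]; simp)
    refine ⟨hmax f hpf, fun hle => ?_⟩
    obtain ⟨c, hc⟩ := hW.exists_eq_smul hb hWgl hvW hv0 hv hw (hpW _) (hpwt f) hle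
    refine weight_unique hpf (hpwt f) fun i => ?_
    rw [hc, map_smul, hv.2, smul_comm]
  have hσ : ∀ σ : Equiv.Perm (Fin n), (∀ j, staircase n (σ j) ≤
        (lam + Finsupp.equivFunOnFinite.symm (staircase n)) j) →
      ∀ i, (lam + Finsupp.equivFunOnFinite.symm (staircase n) -
        Finsupp.equivFunOnFinite.symm fun j => staircase n (σ j)) i + staircase n (σ i) =
          lam i + staircase n i := by
    intro σ h i
    have := h i
    simp only [Finsupp.add_apply, Finsupp.tsub_apply,
      Finsupp.equivFunOnFinite_symm_apply_apply] at this ⊢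
    omega
  rw [if_congr hiff rfl rfl]
  split_ifs with hνlam
  · subst hνlam
    -- A permutation σ contributes through the weight λ+δ-σδ, whose pairing is at least that of ν;
    -- so this weight is ν and σ is the identity.
    rw [coeff_vdm_mul, Finset.sum_eq_single 1]
    · rw [if_pos (by simp)]
      have : (ν + Finsupp.equivFunOnFinite.symm (staircase n) - Finsupp.equivFunOnFinite.symm
          fun j => staircase n ((1 : Equiv.Perm (Fin n)) j)) = ν := by
        ext i; simp
      rw [this, coeff_traceGen, Equiv.Perm.sign_one]
      have hcv : ∀ f, ∃ c : ℂ, wt f = ν → p (b f) = c • v := by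
        intro f
        by_cases hf : wt f = ν
        · obtain ⟨c, hc⟩ := hW.exists_eq_smul hb hWgl hvW hv0 hv hw (hpW _) (hpwt f)
            (le_of_eq (by rw [hf]))
          exact ⟨c, fun _ => hc⟩
        · exact ⟨0, fun h => absurd h hf⟩
      choose c hc using hcv
      -- Applying p to the expansion of v shows that the diagonal entries of p over the weight ν add
      -- up to 1.
      have h1 : v = (∑ f, if wt f = ν then c f * b.repr v f else 0) • v := by
        conv_lhs => rw [← hp v hvW, ← b.sum_repr v, map_sum]
        rw [Finset.sum_smul]
        refine Finset.sum_congr rfl fun f _ => ?_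
        split_ifs with hf
        · rw [map_smul, hc f hf, smul_smul, mul_comm]
        · have : b.repr v f = 0 := by
            by_contra h
            exact hf (wt_eq hv.2 f h)
          rw [this]; simp
      have h2 : (1 : ℂ) = _ := smul_left_injective ℂ hv0 ((one_smul ℂ v).trans h1)
      rw [Units.val_one, Int.cast_one, one_mul, h2]
      refine Finset.sum_congr rfl fun f _ => ?_
      split_ifs with hf
      · rw [hc f hf]; simp
      · rfl
    · intro σ _ hσ1
      split_ifs with h
      · have hσ' := hσ σ h
        rw [mul_eq_zero]
        right
        by_contra hne
        obtain ⟨-, h2⟩ := hterm hne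
        have h3 := h2 (pairing_le_of_add_comp_perm hw hσ')
        rw [h3] at hσ'
        refine hσ1 (Equiv.ext fun i => ?_)
        exact (staircase_strictAnti n).injective (Nat.add_left_cancel (hσ' i))
      · rfl
    · simp
  · by_contra hne
    refine hνlam (eq_of_pairing_le_of_sum_sq ?_ ?_)
    · rw [coeff_vdm_mul] at hne
      obtain ⟨σ, -, hσ0⟩ := Finset.exists_ne_zero_of_sum_ne_zero hne
      by_cases h : ∀ j, staircase n (σ j) ≤
        (lam + Finsupp.equivFunOnFinite.symm (staircase n)) j
      · rw [if_pos h] at hσ0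
        exact (pairing_le_of_add_comp_perm hw (hσ σ h)).trans
          (hterm (right_ne_zero_of_mul hσ0)).1
      · exact absurd (if_neg h) hσ0
    · have hcas : casimir ρ * p =
          (∑ i, (ν i : ℂ) ^ 2 + ∑ p ∈ posPairs n, ((ν p.1 : ℂ) - ν p.2)) • p := by
        -- The Casimir eigenspace contains v and is stable under lowering, hence contains W.
        have hle : W ≤ LinearMap.ker (casimir ρ -
            (∑ i, (ν i : ℂ) ^ 2 + ∑ p ∈ posPairs n, ((ν p.1 : ℂ) - ν p.2)) • 1) := by
          refine hW.le_of_lowering hWgl hvW hv0 hv ?_ fun i j _ u hu => ?_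
          · simp [hv.casimir_apply]
          · rw [LinearMap.mem_ker, LinearMap.sub_apply, LinearMap.smul_apply, Module.End.one_apply,
              sub_eq_zero] at hu ⊢
            rw [← Module.End.mul_apply, casimir_mul_unitOp, Module.End.mul_apply, hu, map_smul]
        refine LinearMap.ext fun x => ?_
        have := hle (hpW x)
        rwa [LinearMap.mem_ker, LinearMap.sub_apply, LinearMap.smul_apply, Module.End.one_apply,
              sub_eq_zero] at this
      have h1 := sum_sq_eq_of_coeff_ne_zero
        (sum_euler_euler_vdm_mul_traceGen hb hN hcomm hcas) hne
      rw [← hνdeg, Finsupp.degree_eq_sum, Nat.cast_sum, highestWeight_const] at h1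
      simp only [Finsupp.add_apply, Finsupp.equivFunOnFinite_symm_apply_apply] at h1
      exact_mod_cast h1

end Projection

end HighestWeights

/-! ### Counting summands by characters, and complete reducibility. -/

section Decompositions

open MvPolynomial Module

variable {n : ℕ} {V : Type*} [AddCommGroup V] [Module ℂ V]
  {ρ : Matrix (Fin n) (Fin n) ℂ →ₗ⁅ℂ⁆ Module.End ℂ V}
  {ι : Type*} [Fintype ι] {b : Basis ι ℂ V} {wt : ι → Fin n →₀ ℕ}

/-- The projection onto a summand of a direct sum decomposition along the other summands. -/
theorem exists_projections {m : ℕ} {S : Fin m → Submodule ℂ V} (hS : DirectSum.IsInternal S) :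
    ∃ p : Fin m → Module.End ℂ V, (∀ a v, p a v ∈ S a) ∧ (∀ a, ∀ v ∈ S a, p a v = v) ∧
      (∀ a a', a ≠ a' → ∀ v ∈ S a', p a v = 0) ∧ ∑ a, p a = 1 := by
  classical
  let e : (DirectSum (Fin m) fun a => S a) ≃ₗ[ℂ] V :=
    LinearEquiv.ofBijective (DirectSum.coeLinearMap S) hS
  have he : ∀ a (v : S a), e.symm v = DirectSum.lof ℂ (Fin m) (fun a => S a) a v := by
    intro a v
    rw [LinearEquiv.symm_apply_eq]
    exact (DirectSum.coeLinearMap_lof S a v).symm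
  refine ⟨fun a => (S a).subtype ∘ₗ DirectSum.component ℂ (Fin m) (fun a => S a) a ∘ₗ
    e.symm.toLinearMap, fun a v => ?_, fun a v hv => ?_, fun a a' hne v hv => ?_, ?_⟩
  · exact Submodule.coe_mem _
  · simp [he a ⟨v, hv⟩, DirectSum.component.lof_self]
  · simp [he a' ⟨v, hv⟩, DirectSum.component.of, hne.symm]
  · refine LinearMap.ext fun v => ?_
    obtain ⟨x, rfl⟩ := e.surjective v
    simp only [LinearMap.sum_apply, LinearMap.comp_apply, LinearEquiv.coe_coe,
      LinearEquiv.symm_apply_apply, Module.End.one_apply]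
    induction x using DirectSum.induction_on with
    | zero => simp
    | of a x =>
      have hx : e (DirectSum.of (fun a => S a) a x) = x := DirectSum.coeLinearMap_lof S a x
      rw [hx, Finset.sum_eq_single a]
      · exact congrArg Subtype.val 
          (DirectSum.component.lof_self (M := fun a => S a) ℂ a x)
      · intro a' _ hne
        have := DirectSum.component.of (M := fun a => S a) ℂ a' a x
        rw [dif_neg hne.symm] at this
        exact congrArg Subtype.val this
      · simp
    | add x y hx hy => simp only [map_add, Finset.sum_add_distrib, hx, hy]

/-- The projections are equivariant because all summands are stable, and they add up to 1; so the
character of V is the sum of those of the summands, each contributing 0 or 1. -/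
theorem IrredDecomposition.count_eq_coeff (hn : n ≠ 0) (hb : IsWeightBasis ρ b wt) {N : ℕ}
    (hN : ∀ f, (wt f).degree = N) (D : IrredDecomposition ρ) {lam : Fin n →₀ ℕ}
    (hanti : Antitone lam) (hlam : lam.degree = N) :
    (D.count (fun i => lam i) : ℂ) =
      coeff (lam + Finsupp.equivFunOnFinite.symm (staircase n)) (vdm n * traceGen b wt 1) := by
  classical
  obtain ⟨p, hpS, hp, hp0, hp1⟩ := exists_projections D.isInternal
  have hcomm : ∀ a i j, p a * unitOp ρ i j = unitOp ρ i j * p a := by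
    intro a i j
    have hmem : ∀ a' x, unitOp ρ i j (p a' x) ∈ D.summand a' := fun a' x =>
      (D.irred a').1.apply_mem hn (map_one_of_degree hb hN) _ (hpS a' x)
    refine LinearMap.ext fun x => ?_
    have hx : x = ∑ a', p a' x := by
      rw [← LinearMap.sum_apply, hp1, Module.End.one_apply]
    conv_lhs => rw [hx]
    simp only [Module.End.mul_apply, map_sum]
    rw [Finset.sum_eq_single a]
    · rw [hp a _ (hmem a x)]
    · intro a' _ hne
      exact hp0 a a' hne.symm _ (hmem a' x)
    · simp
  rw [← hp1, traceGen_sum, Finset.mul_sum, coeff_sum]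
  rw [Finset.sum_congr rfl fun a _ =>
    coeff_vdm_mul_traceGen hn hb hN (D.irred a) (hpS a) (hp a) (hcomm a) hanti hlam]
  rw [IrredDecomposition.count, Nat.card_eq_fintype_card, Fintype.card_subtype]
  simp

/-- A weighted basis for which the matrix units `E_ij` and `E_ji` act by adjoint operators. -/
def IsHermitianBasis (ρ : Matrix (Fin n) (Fin n) ℂ →ₗ⁅ℂ⁆ Module.End ℂ V) (b : Basis ι ℂ V)
    (w : ι → ℝ) : Prop :=
  (∀ f, 0 < w f) ∧ ∀ i j f g, (w g : ℂ) * b.repr (unitOp ρ i j (b f)) g =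
    w f * star (b.repr (unitOp ρ j i (b g)) f)

/-- Unitary trick: in the inner product with |b f|² = w f, E_ij and E_ji are adjoint, so `su n` acts
by skew-adjoint operators and orthogonal complements are stable. -/
theorem exists_isCompl_isSubrep {w : ι → ℝ} (hw : IsHermitianBasis ρ b w) {U : Submodule ℂ V}
    (hU : IsSubrep ρ U) : ∃ U', IsSubrep ρ U' ∧ IsCompl U U' := by
  classical
  obtain ⟨hw0, hw⟩ := hw
  have hs : ∀ f, ((√(w f) : ℝ) : ℂ) ≠ 0 := fun f =>
    Complex.ofReal_ne_zero.mpr (Real.sqrt_pos.mpr (hw0 f)).ne'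
  let e : V ≃ₗ[ℂ] EuclideanSpace ℂ ι := b.equivFun ≪≫ₗ
    (LinearEquiv.piCongrRight fun f => LinearEquiv.smulOfNeZero ℂ ℂ _ (hs f)) ≪≫ₗ
    (WithLp.linearEquiv 2 ℂ (ι → ℂ)).symm
  have he : ∀ x f, e x f = ((√(w f) : ℝ) : ℂ) * b.repr x f := fun x f => rfl
  have hinner : ∀ x y, inner ℂ (e x) (e y) = ∑ f, (w f : ℂ) * (star (b.repr x f) * b.repr y f) := by
    intro x y
    rw [PiLp.inner_apply]
    refine Finset.sum_congr rfl fun f _ => ?_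
    have h2 : ((√(w f) : ℝ) : ℂ) * ((√(w f) : ℝ) : ℂ) = w f := by
      rw [← Complex.ofReal_mul, Real.mul_self_sqrt (hw0 f).le]
    rw [he, he, RCLike.inner_apply, map_mul, Complex.conj_ofReal, ← h2, starRingEnd_apply]
    ring
  have hunit : ∀ i j x y, inner ℂ (e (unitOp ρ i j x)) (e y) =
      inner ℂ (e x) (e (unitOp ρ j i y)) := by
    intro i j x y
    have hx : ∀ (k l : Fin n) (z : V) f, b.repr (unitOp ρ k l z) f =
        ∑ g, b.repr z g * b.repr (unitOp ρ k l (b g)) f := by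
      intro k l z f
      conv_lhs => rw [← b.sum_repr z, map_sum, map_sum]
      simp
    rw [hinner, hinner]
    simp_rw [hx i j x, hx j i y, star_sum, star_mul', Finset.mul_sum, Finset.sum_mul, Finset.mul_sum]
    rw [Finset.sum_comm]
    refine Finset.sum_congr rfl fun f _ => Finset.sum_congr rfl fun g _ => ?_
    have := hw j i g f
    linear_combination -(star (b.repr x f) * b.repr y g) * this
  have hsu : ∀ A ∈ su n, ∀ x y, inner ℂ (e (ρ A x)) (e y) = - inner ℂ (e x) (e (ρ A y)) := by
    intro A hA x y
    have hA' : ∀ i j, star (A i j) = - A j i := fun i j => by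
      have := congrFun (congrFun hA.1 j) i
      simpa using this
    rw [map_eq_sum_unitOp ρ A]
    simp only [LinearMap.sum_apply, LinearMap.smul_apply, map_sum, map_smul, sum_inner, inner_sum,
      inner_smul_left, inner_smul_right, hunit, starRingEnd_apply, hA', neg_mul,
      Finset.sum_neg_distrib]
    rw [Finset.sum_comm]
  refine ⟨((U.map e.toLinearMap)ᗮ).comap e.toLinearMap, fun A hA y hy => ?_, ?_⟩
  · rw [Submodule.mem_comap, Submodule.mem_orthogonal] at hy ⊢
    rintro _ ⟨x, hx, rfl⟩
    have := hsu A hA x y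
    rw [eq_neg_iff_add_eq_zero, add_comm] at this
    exact (eq_neg_of_add_eq_zero_left this).trans
      (neg_eq_zero.mpr (hy _ ⟨ρ A x, hU A hA x hx, rfl⟩))
  · have h := (U.map e.toLinearMap).isCompl_orthogonal
    have h' := (Submodule.orderIsoMapComap e).symm.isCompl_iff.mp h
    have hU' : (Submodule.orderIsoMapComap e).symm (U.map e.toLinearMap) = U :=
      Submodule.comap_map_eq_of_injective e.injective U
    rw [hU'] at h'
    exact h'

/-- Subrepresentations are the submodules over the associative algebra generated by the image of `su
n`, so the theory of semisimple modules applies; finite dimension makes the family of simple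
summands finite. -/
theorem nonempty_irredDecomposition {w : ι → ℝ} (hw : IsHermitianBasis ρ b w) :
    Nonempty (IrredDecomposition ρ) := by
  classical
  let A : Subalgebra ℂ (Module.End ℂ V) := Algebra.adjoin ℂ (ρ '' (su n : Set _))
  have hρ : ∀ (U : Submodule A V), IsSubrep ρ (U.restrictScalars ℂ) := fun U a ha v hv =>
    U.smul_mem (⟨ρ a, Algebra.subset_adjoin ⟨a, ha, rfl⟩⟩ : A) hv
  have lift : ∀ U : Submodule ℂ V, IsSubrep ρ U →
      ∃ U' : Submodule A V, U'.restrictScalars ℂ = U := by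
    intro U hU
    have hA : ∀ T ∈ A, ∀ v ∈ U, T v ∈ U := by
      intro T hT
      induction hT using Algebra.adjoin_induction with
      | mem x hx => obtain ⟨a, ha, rfl⟩ := hx; exact hU a ha
      | algebraMap r => exact fun v hv => U.smul_mem r hv
      | add x y _ _ hx hy => exact fun v hv => U.add_mem (hx v hv) (hy v hv)
      | mul x y _ _ hx hy => exact fun v hv => hx _ (hy v hv)
    exact ⟨{ U with smul_mem' := fun T v hv => hA T T.2 v hv }, rfl⟩
  have hss : IsSemisimpleModule A V := by
    refine { exists_isCompl := fun U => ?_ }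
    obtain ⟨U', hU', hc⟩ := exists_isCompl_isSubrep hw (hρ U)
    obtain ⟨U'', rfl⟩ := lift U' hU'
    refine ⟨U'', ?_⟩
    rw [isCompl_iff, Submodule.disjoint_def, codisjoint_iff, Submodule.eq_top_iff'] at hc ⊢
    refine ⟨fun x => hc.1 x, fun x => ?_⟩
    have := hc.2 x
    rw [Submodule.mem_sup] at this ⊢
    exact this
  have : FiniteDimensional ℂ V := b.finiteDimensional_of_finite
  have : IsNoetherian A V := isNoetherian_of_tower ℂ inferInstance
  obtain ⟨s, hind, hsup, hsimple⟩ := IsSemisimpleModule.exists_sSupIndep_sSup_simples_eq_top A V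
  rw [sSupIndep_iff] at hind
  have hfin : Finite s := WellFoundedGT.finite_of_iSupIndep hind fun S =>
    (isSimpleModule_iff_isAtom.mp (hsimple S S.2)).1
  let f := (Finite.equivFin s).symm
  have hint : DirectSum.IsInternal fun a => (f a : Submodule A V) := by
    refine DirectSum.isInternal_submodule_of_iSupIndep_of_iSup_eq_top (hind.comp f.injective) ?_
    rw [← hsup, sSup_eq_iSup']
    exact f.iSup_comp (g := fun S : s => (S : Submodule A V))
  refine ⟨⟨_, fun a => (f a : Submodule A V).restrictScalars ℂ, hint, fun a => ?_⟩⟩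
  have hat := isSimpleModule_iff_isAtom.mp (hsimple _ (f a).2)
  refine ⟨hρ _, fun h => hat.1 ?_, fun U hle hU => ?_⟩
  · rwa [Submodule.restrictScalars_eq_bot_iff] at h
  · obtain ⟨U', rfl⟩ := lift U hU
    rcases hat.le_iff.mp (show U' ≤ f a from hle) with h | h
    · left; rw [h]; rfl
    · right; rw [h]

end Decompositions

/-! ### Weight bases and Hermitian bases of tensor powers. -/

section TensorPowers

open MvPolynomial Module

variable {n : ℕ} {V : Type*} [AddCommGroup V] [Module ℂ V]
  {ρ : Matrix (Fin n) (Fin n) ℂ →ₗ⁅ℂ⁆ Module.End ℂ V} {κ : Type*} {B : Basis κ ℂ V}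

/-- The basis of a tensor power formed by the tensor products of basis vectors. -/
def tensorBasis (B : Basis κ ℂ V) (L : ℕ) : Basis (Fin L → κ) ℂ (TensorSpace V L) :=
  Basis.piTensorProduct fun _ : Fin L => B

theorem tensorRep_tensorBasis (A : Matrix (Fin n) (Fin n) ℂ) (L : ℕ) (f : Fin L → κ) :
    tensorRep ρ L A (tensorBasis B L f) = ∑ l : Fin L, PiTensorProduct.tprod ℂ fun l' =>
      Function.update (fun _ : Fin L => (LinearMap.id : V →ₗ[ℂ] V)) l (ρ A) l' (B (f l')) := by
  change (∑ l : Fin L, PiTensorProduct.map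
    (Function.update (fun _ : Fin L => (LinearMap.id : V →ₗ[ℂ] V)) l (ρ A)))
      (Basis.piTensorProduct (fun _ : Fin L => B) f) = _
  rw [LinearMap.sum_apply, Basis.piTensorProduct_apply]
  refine Finset.sum_congr rfl fun l _ => ?_
  rw [PiTensorProduct.map_tprod]

theorem repr_tensorRep_tensorBasis (A : Matrix (Fin n) (Fin n) ℂ) (L : ℕ) (f g : Fin L → κ) :
    (tensorBasis B L).repr (tensorRep ρ L A (tensorBasis B L f)) g = ∑ l : Fin L, ∏ l',
      B.repr (Function.update (fun _ : Fin L => (LinearMap.id : V →ₗ[ℂ] V)) l (ρ A) l' (B (f l')))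
        (g l') := by
  rw [tensorRep_tensorBasis, map_sum, Finsupp.coe_finsetSum, Finset.sum_apply]
  exact Finset.sum_congr rfl fun l _ => Basis.piTensorProduct_repr_tprod_apply _ _ _

theorem IsHermitianBasis.tensorBasis {v : κ → ℝ} (hB : IsHermitianBasis ρ B v) (L : ℕ) :
    IsHermitianBasis (tensorRep ρ L) (tensorBasis B L) fun f => ∏ l, v (f l) := by
  classical
  refine ⟨fun f => Finset.prod_pos fun l _ => hB.1 _, fun i j f g => ?_⟩
  rw [repr_tensorRep_tensorBasis, repr_tensorRep_tensorBasis, star_sum, Finset.mul_sum,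
    Finset.mul_sum]
  refine Finset.sum_congr rfl fun l _ => ?_
  push_cast
  rw [star_prod, ← Finset.prod_mul_distrib, ← Finset.prod_mul_distrib]
  refine Finset.prod_congr rfl fun l' _ => ?_
  by_cases hl : l' = l
  · subst hl
    rw [Function.update_self, Function.update_self]
    exact hB.2 i j _ _
  · rw [Function.update_of_ne hl, Function.update_of_ne hl]
    by_cases hfg : f l' = g l'
    · simp [hfg]
    · simp [hfg, Ne.symm hfg]

theorem IsWeightBasis.tensorBasis {wt : κ → Fin n →₀ ℕ} (hB : IsWeightBasis ρ B wt) (L : ℕ) :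
    IsWeightBasis (tensorRep ρ L) (tensorBasis B L) fun f => ∑ l, wt (f l) := by
  classical
  intro f i
  have h : ∀ l : Fin L, (PiTensorProduct.tprod ℂ fun l' =>
      Function.update (fun _ : Fin L => (LinearMap.id : V →ₗ[ℂ] V)) l (unitOp ρ i i) l' (B (f l'))) =
        (wt (f l) i : ℂ) • SpinChain.tensorBasis B L f := by
    intro l
    have h1 : (fun l' => Function.update (fun _ : Fin L => (LinearMap.id : V →ₗ[ℂ] V)) l
        (unitOp ρ i i) l' (B (f l'))) =
          Function.update (fun l' => B (f l')) l ((wt (f l) i : ℂ) • B (f l)) := by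
      funext l'
      by_cases hl : l' = l
      · subst hl
        rw [Function.update_self, Function.update_self, hB]
      · rw [Function.update_of_ne hl, Function.update_of_ne hl, LinearMap.id_apply]
    rw [h1, MultilinearMap.map_update_smul, Function.update_eq_self]
    congr 1
    exact (Basis.piTensorProduct_apply _ _).symm
  rw [unitOp, tensorRep_tensorBasis]
  simp only [h, ← Finset.sum_smul, Finsupp.coe_finsetSum, Finset.sum_apply, Nat.cast_sum]

end TensorPowers

/-! ### The monomial basis of the symmetric power and the character of the chain. -/

section SymmetricPowers

open MvPolynomial Module

/-- The exponents of the monomials of degree `k` in `n` variables. -/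
abbrev monomialExponents (n k : ℕ) : Finset (Fin n →₀ ℕ) :=
  Finset.finsuppAntidiag Finset.univ k

theorem mem_monomialExponents {n k : ℕ} {d : Fin n →₀ ℕ} :
    d ∈ monomialExponents n k ↔ d.degree = k := by
  simp [Finset.mem_finsuppAntidiag, Finsupp.degree_eq_sum]

theorem monomial_mem {n k : ℕ} (d : monomialExponents n k) :
    (monomial (d : Fin n →₀ ℕ) (1 : ℂ)) ∈ homogeneousSubmodule (Fin n) ℂ k := by
  rw [mem_homogeneousSubmodule]
  exact isHomogeneous_monomial _ (mem_monomialExponents.mp d.2)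

/-- The monomial basis of the symmetric power. -/
def symBasis (n k : ℕ) : Basis (monomialExponents n k) ℂ (SymSpace n k) :=
  Basis.ofEquivFun
    { toFun := fun p d => coeff d (p : MvPolynomial (Fin n) ℂ)
      map_add' := fun p q => by ext; simp
      map_smul' := fun c p => by ext; simp
      invFun := fun c => ∑ d, c d • ⟨monomial (d : Fin n →₀ ℕ) 1, monomial_mem d⟩
      left_inv := fun p => by
        classical
        refine Subtype.ext (MvPolynomial.ext _ _ fun m => ?_)
        simp only [AddSubmonoidClass.coe_finsetSum, Submodule.coe_smul, coeff_sum, coeff_smul,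
          coeff_monomial, smul_eq_mul, mul_ite, mul_one, mul_zero]
        by_cases hm : m ∈ monomialExponents n k
        · rw [Finset.sum_eq_single ⟨m, hm⟩]
          · simp
          · intro d _ hd
            rw [if_neg fun h => hd (Subtype.ext h)]
          · simp
        · rw [Finset.sum_eq_zero fun d _ => if_neg fun h =>
              hm (Eq.subst (motive := (· ∈ monomialExponents n k)) h d.2)]
          have hp := p.2
          rw [mem_homogeneousSubmodule] at hp
          exact (hp.coeff_eq_zero fun h => hm (mem_monomialExponents.mpr h)).symm
      right_inv := fun c => by
        classical
        funext m
        simp only [AddSubmonoidClass.coe_finsetSum, Submodule.coe_smul, coeff_sum, coeff_smul,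
          coeff_monomial, smul_eq_mul, mul_ite, mul_one, mul_zero]
        rw [Finset.sum_eq_single m]
        · simp
        · intro d _ hd
          rw [if_neg fun h => hd (Subtype.ext h)]
        · simp }

theorem symBasis_repr {n k : ℕ} (p : SymSpace n k) (d : monomialExponents n k) :
    (symBasis n k).repr p d = coeff (d : Fin n →₀ ℕ) (p : MvPolynomial (Fin n) ℂ) := rfl

theorem coe_symBasis {n k : ℕ} (d : monomialExponents n k) :
    (symBasis n k d : MvPolynomial (Fin n) ℂ) = monomial (d : Fin n →₀ ℕ) 1 := by
  classical
  refine congrArg Subtype.val (?_ : symBasis n k d = ⟨_, monomial_mem d⟩)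
  refine (symBasis n k).ext_elem fun d' => ?_
  rw [Basis.repr_self, symBasis_repr, coeff_monomial, Finsupp.single_apply]
  exact if_congr Subtype.ext_iff rfl rfl

theorem matrixDerivation_single {n : ℕ} (i j : Fin n) :
    matrixDerivation (Matrix.single i j 1) = (X i : MvPolynomial (Fin n) ℂ) • pderiv j := by
  refine MvPolynomial.derivation_ext fun l => ?_
  rw [matrixDerivation_X, Derivation.smul_apply, pderiv_X, Pi.single_apply]
  simp only [Matrix.single_apply, ite_and, ite_smul, one_smul, zero_smul, smul_eq_mul, mul_ite,
    mul_one, mul_zero]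
  simp [eq_comm]

theorem coe_symRep_symBasis {n k : ℕ} (i j : Fin n) (d : monomialExponents n k) :
    (unitOp (symRep n k) i j (symBasis n k d) : MvPolynomial (Fin n) ℂ) =
      X i * pderiv j (monomial (d : Fin n →₀ ℕ) 1) := by
  change matrixDerivation (Matrix.single i j 1) (symBasis n k d : MvPolynomial (Fin n) ℂ) = _
  rw [coe_symBasis, matrixDerivation_single]
  rfl

theorem isWeightBasis_symBasis (n k : ℕ) :
    IsWeightBasis (symRep n k) (symBasis n k) fun d => (d : Fin n →₀ ℕ) := by
  intro d i
  refine Subtype.ext ?_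
  rw [coe_symRep_symBasis, X_mul_pderiv_monomial, Submodule.coe_smul, coe_symBasis,
    Nat.cast_smul_eq_nsmul]

theorem repr_symRep_symBasis {n k : ℕ} (i j : Fin n) (d d' : monomialExponents n k) :
    (symBasis n k).repr (unitOp (symRep n k) i j (symBasis n k d)) d' =
      if (d' : Fin n →₀ ℕ) + Finsupp.single j 1 = (d : Fin n →₀ ℕ) + Finsupp.single i 1
      then (((d : Fin n →₀ ℕ) j : ℕ) : ℂ) else 0 := by
  classical
  rw [symBasis_repr, coe_symRep_symBasis, pderiv_monomial, one_mul, X, monomial_mul, one_mul,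
    coeff_monomial]
  by_cases hd : (d : Fin n →₀ ℕ) j = 0
  · simp [hd]
  · have hle : Finsupp.single j 1 ≤ (d : Fin n →₀ ℕ) :=
      Finsupp.single_le_iff.mpr (Nat.one_le_iff_ne_zero.mpr hd)
    refine if_congr ?_ rfl rfl
    rw [← add_left_inj (Finsupp.single j 1), add_assoc, tsub_add_cancel_of_le hle, add_comm, eq_comm]

theorem prod_factorial_add_single {n : ℕ} (d : Fin n →₀ ℕ) (i : Fin n) :
    ∏ l, ((d + Finsupp.single i 1 : Fin n →₀ ℕ) l).factorial = (∏ l, (d l).factorial) * (d i + 1) := by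
  classical
  rw [← Finset.mul_prod_erase _ _ (Finset.mem_univ i),
    ← Finset.mul_prod_erase _ (fun l => (d l).factorial) (Finset.mem_univ i),
    Finset.prod_congr rfl fun l hl => by
      rw [Finsupp.add_apply, Finsupp.single_eq_of_ne (Finset.ne_of_mem_erase hl), add_zero]]
  rw [Finsupp.add_apply, Finsupp.single_eq_same, Nat.factorial_succ]
  ring

/-- In the inner product with |x^d|² = ∏ d_l!, multiplication by a variable is adjoint to
differentiation by it, so X_i ∂_j and X_j ∂_i are adjoint. -/
theorem isHermitianBasis_symBasis (n k : ℕ) :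
    IsHermitianBasis (symRep n k) (symBasis n k)
      fun d => ((∏ l, ((d : Fin n →₀ ℕ) l).factorial : ℕ) : ℝ) := by
  refine ⟨fun d => Nat.cast_pos.mpr (Finset.prod_pos fun l _ => Nat.factorial_pos _),
    fun i j d d' => ?_⟩
  rw [repr_symRep_symBasis, repr_symRep_symBasis]
  by_cases h : (d' : Fin n →₀ ℕ) + Finsupp.single j 1 = (d : Fin n →₀ ℕ) + Finsupp.single i 1
  · rw [if_pos h, if_pos h.symm, star_natCast, Complex.ofReal_natCast, Complex.ofReal_natCast]
    norm_cast
    by_cases hij : i = j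
    · subst hij
      rw [add_left_inj] at h
      rw [h]
    -- Both sides equal the factorial product of the common exponent d' + e_j = d + e_i.
    · have h1 := prod_factorial_add_single (d' : Fin n →₀ ℕ) j
      have h2 := prod_factorial_add_single (d : Fin n →₀ ℕ) i
      have hj := DFunLike.congr_fun h j
      have hi := DFunLike.congr_fun h i
      simp only [Finsupp.add_apply, Finsupp.single_eq_same, Finsupp.single_eq_of_ne hij,
        Finsupp.single_eq_of_ne (Ne.symm hij), add_zero] at hi hj
      rw [← hj, hi, ← h1, ← h2, h]
  · rw [if_neg h, if_neg (Ne.symm h)]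
    simp

/-- The complete homogeneous symmetric polynomial as a sum of monomials. -/
def completeHom (R : Type*) [CommSemiring R] (n k : ℕ) : MvPolynomial (Fin n) R :=
  ∑ d ∈ monomialExponents n k, monomial d 1

theorem traceGen_one_chain (n k L : ℕ) :
    traceGen (tensorBasis (symBasis n k) L) (fun f => ∑ l, (f l : Fin n →₀ ℕ)) 1 =
      completeHom ℂ n k ^ L := by
  classical
  rw [completeHom, ← Finset.sum_coe_sort, ← Fin.prod_const, Finset.prod_univ_sum,
    Fintype.piFinset_univ, traceGen]
  refine Finset.sum_congr rfl fun f _ => ?_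
  rw [Module.End.one_apply, Basis.repr_self, Finsupp.single_eq_same, monomial_sum_one]

theorem chain_count_eq_coeff (r k L : ℕ) (D : IrredDecomposition (chainRep r k L))
    {lam : Fin (r + 1) →₀ ℕ} (hanti : Antitone lam) (hlam : lam.degree = k * L) :
    (D.count (fun i => lam i) : ℂ) =
      coeff (lam + Finsupp.equivFunOnFinite.symm (staircase (r + 1)))
        (vdm (r + 1) * completeHom ℂ (r + 1) k ^ L) := by
  rw [← traceGen_one_chain]
  refine D.count_eq_coeff (Nat.succ_ne_zero r)
    ((isWeightBasis_symBasis (r + 1) k).tensorBasis L) (N := k * L) (fun f => ?_) hanti hlam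
  rw [map_sum, Finset.sum_congr rfl fun l _ => mem_monomialExponents.mp (f l).2]
  simp [mul_comm]

theorem nonempty_chain_irredDecomposition (r k L : ℕ) :
    Nonempty (IrredDecomposition (chainRep r k L)) :=
  nonempty_irredDecomposition ((isHermitianBasis_symBasis (r + 1) k).tensorBasis L)

end SymmetricPowers

/-! ### The one-row Schur polynomial is the complete homogeneous polynomial. -/

section OneRow

open MvPolynomial

theorem geometric_mul_one_sub {R : Type*} [CommRing R] (x : R) :
    (PowerSeries.mk fun m => x ^ m) * (1 - PowerSeries.C x * PowerSeries.X) = 1 := by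
  ext m
  rw [mul_sub, mul_one, ← mul_assoc, map_sub, PowerSeries.coeff_mk]
  cases m with
  | zero => simp
  | succ m =>
    rw [PowerSeries.coeff_succ_mul_X, PowerSeries.coeff_mul_C, PowerSeries.coeff_mk]
    simp [pow_succ, PowerSeries.coeff_one]

/-- The alternants of the one-row partitions as the coefficients of a determinant of power
series. -/
theorem alternant_one_row (r k : ℕ) :
    alternant (fun i : Fin (r + 1) => (if i = 0 then k else 0) + (r + 1 - 1 - (i : ℕ))) =
      alternant (staircase (r + 1)) * completeHom ℤ (r + 1) k := by
  classical
  set R := MvPolynomial (Fin (r + 1)) ℤ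
  let x : Fin (r + 1) → R := fun j => X j
  let geo : Fin (r + 1) → PowerSeries R := fun j => PowerSeries.mk fun m => x j ^ m
  let A : Matrix (Fin (r + 1)) (Fin (r + 1)) (PowerSeries R) := Matrix.of fun i j =>
    PowerSeries.C (x j ^ staircase (r + 1) i)
  let B : Matrix (Fin (r + 1)) (Fin (r + 1)) (PowerSeries R) := Matrix.of fun i j =>
    if i = 0 then A i j else (1 - PowerSeries.C (x j) * PowerSeries.X) * A i j
  -- Only row 0 involves the power series variable, so the k-th coefficient of the determinant is
  -- the alternant with its first exponent raised by k.
  let Γ : Matrix (Fin (r + 1)) (Fin (r + 1)) (PowerSeries R) := Matrix.of fun i j =>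
    if i = 0 then geo j * A i j else A i j
  -- Each row of B after the first is the row of A minus `PowerSeries.X` times the preceding row of
  -- A.
  have hAB : A.det = B.det := by
    refine Matrix.det_eq_of_forall_row_eq_smul_add_pred (fun _ => PowerSeries.X)
      (fun j => by simp [B]) fun i j => ?_
    have h : staircase (r + 1) (Fin.castSucc i) = staircase (r + 1) i.succ + 1 := by
      simp only [staircase, Fin.val_castSucc, Fin.val_succ]
      have := i.isLt
      omega
    simp only [B, A, Matrix.of_apply, h, if_neg (Fin.succ_ne_zero i), pow_succ, map_mul]
    ring
  -- Scaling column j by 1 - x_j X cancels the geometric series in row 0 and produces the remaining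
  -- rows of B.
  have hΓB : (∏ j, (1 - PowerSeries.C (x j) * PowerSeries.X)) * Γ.det = B.det := by
    rw [← Matrix.det_mul_row]
    congr 1
    ext1 i j
    simp only [Matrix.of_apply, Γ, B]
    split_ifs
    · rw [← mul_assoc, mul_comm _ (geo j), geometric_mul_one_sub, one_mul]
    · rfl
  have hgeo : (∏ j, geo j) * ∏ j, (1 - PowerSeries.C (x j) * PowerSeries.X) = 1 := by
    rw [← Finset.prod_mul_distrib]
    exact Finset.prod_eq_one fun j _ => geometric_mul_one_sub _
  have hA : A.det = PowerSeries.C (alternant (staircase (r + 1))) := by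
    rw [alternant, RingHom.map_det]
    rfl
  have hΓ : Γ.det = PowerSeries.C (alternant (staircase (r + 1))) * ∏ j, geo j := by
    rw [← hA, hAB, ← hΓB]
    linear_combination -Γ.det * hgeo
  have hcoeff : PowerSeries.coeff k (∏ j, geo j) = completeHom ℤ (r + 1) k := by
    rw [PowerSeries.coeff_prod, completeHom]
    refine Finset.sum_congr rfl fun d _ => ?_
    rw [monomial_eq, Finsupp.prod_fintype _ _ (by simp)]
    simp [geo, x]
  rw [← hcoeff, ← PowerSeries.coeff_C_mul, ← hΓ, alternant, Matrix.det_succ_row_zero,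
    Matrix.det_succ_row_zero, map_sum]
  refine Finset.sum_congr rfl fun j _ => ?_
  have hminor : (Γ.submatrix Fin.succ j.succAbove).det = PowerSeries.C ((Matrix.of fun i j : Fin (r + 1) =>
      (X j : R) ^ ((if i = 0 then k else 0) + (r + 1 - 1 - (i : ℕ)))).submatrix
        Fin.succ j.succAbove).det := by
    rw [RingHom.map_det]
    congr 1
    ext1 i l
    simp [Γ, A, x, staircase, Fin.succ_ne_zero]
  rw [hminor, PowerSeries.coeff_mul_C]
  congr 1
  have hsign : ((-1 : PowerSeries R)) ^ (j : ℕ) = PowerSeries.C ((-1) ^ (j : ℕ)) := by simp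
  rw [hsign, PowerSeries.coeff_C_mul]
  congr 1
  simp only [Γ, A, Matrix.of_apply, if_true, PowerSeries.coeff_mul_C, geo, PowerSeries.coeff_mk, x,
    staircase]
  rw [← pow_add]

theorem schur_one_row (r k : ℕ) :
    schur (fun i : Fin (r + 1) => if i = 0 then k else 0) = completeHom ℤ (r + 1) k := by
  refine mul_left_cancel₀ (alternant_ne_zero (r + 1)) ?_
  rw [← schur_spec]
  exact alternant_one_row r k

end OneRow

/-! ### From the variables y_j to the simple-root variables x_a. -/

section Substitution

open MvPolynomial

/-- The substitution `y_j ↦ x_1 ⋯ x_j`. -/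
def rootSubst (r : ℕ) : MvPolynomial (Fin (r + 1)) ℤ →ₐ[ℤ] MvPolynomial (Fin r) ℤ :=
  aeval fun j : Fin (r + 1) => ∏ i ∈ Finset.univ.filter (fun i : Fin r => (i : ℕ) < (j : ℕ)),
    (X i : MvPolynomial (Fin r) ℤ)

/-- The exponents `∑_{j > i} m_j` of the image of a monomial under `rootSubst`. -/
def tailSums {r : ℕ} (m : Fin (r + 1) →₀ ℕ) : Fin r →₀ ℕ :=
  Finsupp.equivFunOnFinite.symm fun i =>
    ∑ j ∈ Finset.univ.filter (fun j : Fin (r + 1) => (i : ℕ) < (j : ℕ)), m j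

theorem tailSums_apply {r : ℕ} (m : Fin (r + 1) →₀ ℕ) (i : Fin r) : tailSums m i =
    ∑ j ∈ Finset.univ.filter (fun j : Fin (r + 1) => (i : ℕ) < (j : ℕ)), m j := rfl

theorem tailSums_add {r : ℕ} (m m' : Fin (r + 1) →₀ ℕ) :
    tailSums (m + m') = tailSums m + tailSums m' := by
  ext i
  simp [tailSums_apply, Finset.sum_add_distrib]

theorem rootSubst_monomial {r : ℕ} (m : Fin (r + 1) →₀ ℕ) (c : ℤ) :
    rootSubst r (monomial m c) = monomial (tailSums m) c := by
  rw [rootSubst, aeval_monomial, Finsupp.prod_fintype _ _ (by simp), monomial_eq,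
    Finsupp.prod_fintype _ _ (by simp)]
  congr 1
  simp only [tailSums_apply, Finset.prod_filter, Finset.sum_filter, ← Finset.prod_pow,
    ← Finset.prod_pow_eq_pow_sum]
  rw [Finset.prod_comm]
  refine Finset.prod_congr rfl fun i _ => Finset.prod_congr rfl fun j _ => ?_
  split_ifs <;> simp

/-- The degree is the tail sum missing from `tailSums`; consecutive tail sums differ by one entry.
-/
theorem tailSums_injective {r : ℕ} {m m' : Fin (r + 1) →₀ ℕ} (hdeg : m.degree = m'.degree)
    (h : tailSums m = tailSums m') : m = m' := by
  have key : ∀ t : ℕ, ∑ j ∈ Finset.univ.filter (fun j : Fin (r + 1) => t ≤ (j : ℕ)), m j =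
      ∑ j ∈ Finset.univ.filter (fun j : Fin (r + 1) => t ≤ (j : ℕ)), m' j := by
    intro t
    rcases t with _ | t
    · simpa [Finsupp.degree_eq_sum] using hdeg
    · by_cases ht : t < r
      · simpa only [tailSums_apply, Nat.succ_le_iff] using DFunLike.congr_fun h ⟨t, ht⟩
      · have : (Finset.univ.filter fun j : Fin (r + 1) => t + 1 ≤ (j : ℕ)) = ∅ := by
          refine Finset.filter_eq_empty_iff.mpr fun j _ => ?_
          have := j.isLt
          omega
        rw [this]; simp
  have split : ∀ (μ : Fin (r + 1) →₀ ℕ) (j : Fin (r + 1)),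
      ∑ l ∈ Finset.univ.filter (fun l : Fin (r + 1) => (j : ℕ) ≤ (l : ℕ)), μ l =
        μ j + ∑ l ∈ Finset.univ.filter (fun l : Fin (r + 1) => (j : ℕ) + 1 ≤ (l : ℕ)), μ l := by
    intro μ j
    rw [← Finset.sum_insert (by simp)]
    refine Finset.sum_congr ?_ fun _ _ => rfl
    ext l
    simp only [Finset.mem_filter, Finset.mem_univ, true_and, Finset.mem_insert, Fin.ext_iff]
    omega
  ext j
  have h1 := key j
  rw [split m j, split m' j, key (j + 1)] at h1
  exact Nat.add_right_cancel h1

theorem coeff_rootSubst {r N : ℕ} {P : MvPolynomial (Fin (r + 1)) ℤ} (hP : P.IsHomogeneous N)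
    {m : Fin (r + 1) →₀ ℕ} (hm : m.degree = N) :
    coeff (tailSums m) (rootSubst r P) = coeff m P := by
  classical
  conv_lhs => rw [P.as_sum]
  rw [map_sum, coeff_sum]
  simp only [rootSubst_monomial, coeff_monomial]
  rw [Finset.sum_eq_single m]
  · rw [if_pos rfl]
  · intro d hd hne
    refine if_neg fun h => hne (tailSums_injective ?_ h)
    rw [hm]
    by_contra hdeg
    exact mem_support_iff.mp hd (hP.coeff_eq_zero hdeg)
  · intro h
    rw [if_pos rfl, notMem_support_iff.mp h]

theorem prod_filter_lt_eq {r : ℕ} {a b : Fin (r + 1)} (hab : a < b) :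
    (∏ i ∈ Finset.univ.filter (fun i : Fin r => (i : ℕ) < (b : ℕ)),
      (X i : MvPolynomial (Fin r) ℤ)) =
    (∏ i ∈ Finset.univ.filter (fun i : Fin r => (i : ℕ) < (a : ℕ)), X i) *
      ∏ i ∈ Finset.univ.filter (fun i : Fin r => (a : ℕ) ≤ i ∧ (i : ℕ) < (b : ℕ)), X i := by
  rw [← Finset.prod_union]
  · refine Finset.prod_congr ?_ fun _ _ => rfl
    ext i
    have := Fin.lt_def.mp hab
    simp only [Finset.mem_filter, Finset.mem_univ, true_and, Finset.mem_union]
    omega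
  · rw [Finset.disjoint_filter]
    intro i _ h1 h2
    omega

/-- The pair (a, b + 1) with a ≤ b corresponds to the root α_a + ⋯ + α_b. -/
theorem prod_posPairs_eq_weylDenominator (r : ℕ) :
    ∏ p ∈ posPairs (r + 1), (1 - ∏ i ∈ Finset.univ.filter
      (fun i : Fin r => (p.1 : ℕ) ≤ i ∧ (i : ℕ) < (p.2 : ℕ)), (X i : MvPolynomial (Fin r) ℤ)) =
    weylDenominator r := by
  rw [weylDenominator, Finset.prod_filter, Finset.prod_filter, Fintype.prod_prod_type,
    Fintype.prod_prod_type, Fin.prod_univ_castSucc]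
  have hlast : ∀ b : Fin (r + 1), ¬ Fin.last r < b := fun b => (Fin.le_last b).not_gt
  simp only [hlast, if_false, Finset.prod_const_one, mul_one]
  refine Finset.prod_congr rfl fun a _ => ?_
  rw [Fin.prod_univ_succ]
  simp only [Fin.not_lt_zero, if_false, one_mul, Fin.castSucc_lt_succ_iff]
  refine Finset.prod_congr rfl fun b _ => if_congr Iff.rfl ?_ rfl
  congr 1
  refine Finset.prod_congr ?_ fun _ _ => rfl
  ext i
  simp only [Finset.mem_filter, Finset.mem_univ, true_and, Fin.val_castSucc, Fin.val_succ,
    Finset.mem_Icc, Fin.le_def, Nat.lt_succ_iff]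

/-- For a < b, y_a - y_b becomes y_a times 1 minus a root monomial, and the factors y_a collect to
y^δ. -/
theorem rootSubst_alternant (r : ℕ) : rootSubst r (alternant (staircase (r + 1))) =
    monomial (tailSums (Finsupp.equivFunOnFinite.symm (staircase (r + 1)))) 1 *
      weylDenominator r := by
  rw [alternant_staircase, ← rootSubst_monomial, monomial_eq, Finsupp.prod_fintype _ _ (by simp),
    ← prod_posPairs_eq_weylDenominator, map_prod]
  have h : (∏ i : Fin (r + 1), (X i : MvPolynomial (Fin (r + 1)) ℤ) ^ staircase (r + 1) i) =
      ∏ p ∈ posPairs (r + 1), X p.1 := by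
    rw [prod_posPairs fun i _ => (X i : MvPolynomial (Fin (r + 1)) ℤ)]
    refine Finset.prod_congr rfl fun i _ => ?_
    rw [Finset.prod_const, Fin.card_Ioi]
    rfl
  simp only [Finsupp.equivFunOnFinite_symm_apply_apply]
  rw [h, map_one, one_mul, map_prod, ← Finset.prod_mul_distrib]
  refine Finset.prod_congr rfl fun p hp => ?_
  have hlt : p.1 < p.2 := by simpa using hp
  simp only [map_sub, rootSubst, aeval_X]
  rw [prod_filter_lt_eq hlt, mul_sub, mul_one]

theorem generatingFunction_eq (r k L : ℕ) :
    generatingFunction r k L = rootSubst r (completeHom ℤ (r + 1) k ^ L) := by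
  rw [generatingFunction, schur_one_row, map_pow]
  rfl

theorem isHomogeneous_alternant {n : ℕ} (e : Fin n → ℕ) :
    (alternant e).IsHomogeneous (∑ i, e i) := by
  rw [alternant_eq_sum]
  refine IsHomogeneous.sum _ _ _ fun σ _ => isHomogeneous_monomial _ ?_
  rw [Finsupp.degree_eq_sum]
  exact Equiv.sum_comp σ e

theorem isHomogeneous_completeHom (R : Type*) [CommSemiring R] (n k : ℕ) :
    (completeHom R n k).IsHomogeneous k :=
  IsHomogeneous.sum _ _ _ fun _ hd => isHomogeneous_monomial _ (mem_monomialExponents.mp hd)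

theorem coeff_alternant_mul_completeHom_pow (r k L : ℕ) {lam : Fin (r + 1) →₀ ℕ}
    (hlam : lam.degree = k * L) :
    coeff (lam + Finsupp.equivFunOnFinite.symm (staircase (r + 1)))
        (alternant (staircase (r + 1)) * completeHom ℤ (r + 1) k ^ L) =
      coeff (tailSums lam) (weylDenominator r * generatingFunction r k L) := by
  rw [← coeff_rootSubst ((isHomogeneous_alternant _).mul
    ((isHomogeneous_completeHom ℤ (r + 1) k).pow L)), map_mul, rootSubst_alternant,
    ← generatingFunction_eq, tailSums_add, add_comm, mul_assoc, coeff_monomial_mul, one_mul]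
  rw [map_add, hlam, Finsupp.degree_eq_sum, add_comm]
  rfl

/-- Multiplication by P convolves coefficients; the value 0 of `occupancy` at negative arguments
matches the terms with β not below m. -/
theorem shiftOperator_occupancy (r k L : ℕ) (P : MvPolynomial (Fin r) ℤ) {M : Fin r → ℤ}
    {m : Fin r →₀ ℕ} (hm : ∀ i, M i = m i) :
    shiftOperator P (occupancy r k L) M = coeff m (P * generatingFunction r k L) := by
  classical
  conv_rhs => rw [P.as_sum, Finset.sum_mul, coeff_sum]
  refine Finset.sum_congr rfl fun β _ => ?_
  rw [coeff_monomial_mul', occupancy, mul_ite, mul_zero]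
  refine if_ctx_congr ?_ (fun h => ?_) fun _ => rfl
  · rw [Finsupp.le_def]
    refine forall_congr' fun i => ?_
    rw [hm]
    omega
  · congr 2
    ext i
    simp only [Finsupp.equivFunOnFinite_symm_apply_apply, Finsupp.tsub_apply, hm]
    omega

theorem sum_filter_weightOf (r k L : ℕ) (M : Fin r → ℤ) {t : ℕ} (ht : t ≤ r + 1) :
    ∑ j ∈ Finset.univ.filter (fun j : Fin (r + 1) => t ≤ (j : ℕ)), weightOf r k L M j =
      if t = 0 then (k : ℤ) * L else if h : t - 1 < r then M ⟨t - 1, h⟩ else 0 := by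
  -- The sequence kL, M_1, …, M_r, 0, whose successive differences are the rows, so tail sums
  -- telescope.
  set F : ℕ → ℤ := fun t => if t = 0 then (k : ℤ) * L else if h : t - 1 < r then M ⟨t - 1, h⟩ else 0
    with hF
  have hw : ∀ j : Fin (r + 1), weightOf r k L M j = F j - F (j + 1) := by
    intro j
    rw [weightOf]
    congr 1
    refine Fin.cases ?_ (fun i => ?_) j <;> simp [hF]
  simp only [hw]
  rw [Finset.sum_filter, Fin.sum_univ_eq_sum_range fun j => if t ≤ j then F j - F (j + 1) else 0]
  have hlast : F (r + 1) = 0 := by simp [hF]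
  have key : ∀ s, t ≤ s → (∑ j ∈ Finset.range s, if t ≤ j then F j - F (j + 1) else 0) =
      F t - F s := by
    intro s hs
    induction s, hs using Nat.le_induction with
    | base =>
      rw [sub_self]
      exact Finset.sum_eq_zero fun j hj => if_neg (not_le.mpr (Finset.mem_range.mp hj))
    | succ s hs ih =>
      rw [Finset.sum_range_succ, ih, if_pos hs]
      ring
  rw [key _ ht, hlast, sub_zero]

end Substitution

end SpinChain

end

/-! ### The counting formula, with k = 2s. -/

theorem mainTheorem1 (r k L : ℕ) (M : Fin r → ℤ)
    (hM : Antitone (SpinChain.weightOf r k L M))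
    (hM_nonneg : 0 ≤ SpinChain.weightOf r k L M (Fin.last r)) :
    Nonempty (SpinChain.IrredDecomposition (SpinChain.chainRep r k L)) ∧
      ∀ D : SpinChain.IrredDecomposition (SpinChain.chainRep r k L),
        (D.count (SpinChain.weightOf r k L M) : ℤ) =
          SpinChain.shiftOperator (SpinChain.weylDenominator r) (SpinChain.occupancy r k L) M := by
  refine ⟨SpinChain.nonempty_chain_irredDecomposition r k L, fun D => ?_⟩
  have hnonneg : ∀ i, 0 ≤ SpinChain.weightOf r k L M i := fun i =>
    hM_nonneg.trans (hM (Fin.le_last i))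
  obtain ⟨lam, hlam⟩ : ∃ lam : Fin (r + 1) →₀ ℕ,
      SpinChain.weightOf r k L M = fun i => (lam i : ℤ) :=
    ⟨Finsupp.equivFunOnFinite.symm fun i => (SpinChain.weightOf r k L M i).toNat,
      funext fun i => (Int.toNat_of_nonneg (hnonneg i)).symm⟩
  have hdeg : lam.degree = k * L := by
    have h := SpinChain.sum_filter_weightOf r k L M (Nat.zero_le _)
    simp only [zero_le, Finset.filter_true, if_true, hlam] at h
    rw [Finsupp.degree_eq_sum]
    exact_mod_cast h
  -- M_a is the sum of the rows of λ after the first a, which is the exponent of x_a after the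
  -- substitution.
  have htail : ∀ i, M i = SpinChain.tailSums lam i := by
    intro i
    have h := SpinChain.sum_filter_weightOf r k L M (t := i + 1) (by omega)
    simp only [Nat.succ_ne_zero, if_false, Nat.add_sub_cancel, i.isLt, dif_pos, hlam,
      Nat.succ_le_iff] at h
    rw [SpinChain.tailSums_apply, Nat.cast_sum]
    exact h.symm
  have hanti : Antitone lam := fun i j hij => by
    have := hM hij
    simp only [hlam] at this
    exact_mod_cast this
  have h := SpinChain.chain_count_eq_coeff r k L D hanti hdeg
  -- Traces live over ℂ and Schur polynomials over ℤ; the complex identity is the image of an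
  -- integral one and descends by injectivity.
  have hmap : SpinChain.vdm (r + 1) * SpinChain.completeHom ℂ (r + 1) k ^ L =
      MvPolynomial.map (Int.castRingHom ℂ)
        (SpinChain.alternant (SpinChain.staircase (r + 1)) *
          SpinChain.completeHom ℤ (r + 1) k ^ L) := by
    simp [SpinChain.vdm, SpinChain.completeHom, MvPolynomial.map_monomial]
  rw [hmap, MvPolynomial.coeff_map, SpinChain.coeff_alternant_mul_completeHom_pow r k L hdeg] at h
  rw [SpinChain.shiftOperator_occupancy r k L _ htail, hlam]
  exact Int.cast_injective (α := ℂ) ((Int.cast_natCast _).trans h)
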